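/- A pattern is a finite directed graph; vertices of a pattern are called terminals. Two patterns are transitively equivalent if their transitive closures are isomorphic. A pattern is obtained from a pattern $H$ by identifying terminals if, for some partition of $V(H)$, it arises (up to isomorphism) by contracting each class of the partition to a single vertex, merging parallel edges, deleting self-loops, and then deleting isolated vertices. For a class $\mathcal{H}$ of patterns, its closure $\mathcal{H}'$ under identifying terminals and transitive equivalence is the smallest class containing $\mathcal{H}$ that contains, with every pattern $H$, all patterns obtained from $H$ by identifying terminals and all patterns transitively equivalent to $H$. The problem $\mathcal{H}$-DSN (Directed Steiner $\mathcal{H}$-Network) is the following. An instance consists of a directed graph $G$ with non-negative integer arc weights (written in binary), a set $R\subseteq V(G)$ of terminals, a pattern $H\in\mathcal{H}$ on the vertex set $R$, and a budget $b\in\mathbb{N}$; the question is whether there is a subgraph $N\subseteq G$ of total arc weight at most $b$ that contains an $s\to t$ path for every edge $st\in E(H)$. The parameter is $k=|R|=|V(H)|$. A parameterized reduction from $\mathcal{A}$ to $\mathcal{B}$ is a map from inputs of $\mathcal{A}$ to inputs of $\mathcal{B}$ that sends instances to instances and satisfies, for all inputs $x$ with parameter $k$: $x$ is a yes-instance of $\mathcal{A}$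 if and only if its image is a yes-instance of $\mathcal{B}$; the image has parameter at most $g(k)$; and the image is computed by a Turing machine in time at most $f(k)\cdot p(|x|)$, where $f,g:\mathbb{N}\to\mathbb{N}$ are computable functions and $p$ is a polynomial. (Inputs of $\mathcal{H}$-DSN are all tuples $(G,R,H,b)$ as above with an arbitrary pattern $H$; those with $H\in\mathcal{H}$ are its instances.) Lemma. Let $\mathcal{H}$ be a recursively enumerable class of patterns, let $\mathcal{H}'$ be the closure of $\mathcal{H}$ under identifying terminals and transitive equivalence, and let $\mathcal{H}''$ be a decidable subclass of $\mathcal{H}'$. Then there is a parameterized reduction from $\mathcal{H}''$-DSN to $\mathcal{H}$-DSN, both with parameter $k$, the number of terminals. -/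

import Mathlib

namespace DSN

/-! ### Patterns and classes of patterns -/

/-- A pattern graph: a finite directed graph, with vertex set `{0, …, order - 1}`. A class of
patterns is a `Set Pattern`; it need not be closed under isomorphism. -/
structure Pattern where
  order : ℕ
  graph : Digraph (Fin order)

/-- The transitive closure of a directed graph. -/
def transClosure {V : Type} (G : Digraph V) : Digraph V where
  Adj := Relation.TransGen G.Adj

/-- Two patterns are transitively equivalent if their transitive closures are isomorphic. -/
def TransEquiv (H H' : Pattern) : Prop :=
  Nonempty ((transClosure H.graph).Adj ≃r (transClosure H'.graph).Adj)

/-- The graph obtained from `G` by contracting every class of the partition `s` of its vertex set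
to a single vertex, where self-loops are removed and parallel edges are merged. -/
def quotientGraph {V : Type} (G : Digraph V) (s : Setoid V) : Digraph (Quotient s) where
  Adj A B := A ≠ B ∧ ∃ a b, Quotient.mk s a = A ∧ Quotient.mk s b = B ∧ G.Adj a b

/-- The vertices of `G` that are not isolated. -/
def NonIsolated {V : Type} (G : Digraph V) : Type :=
  {v : V // ∃ u, G.Adj v u ∨ G.Adj u v}

/-- The graph obtained from `G` by removing its isolated vertices. -/
def removeIsolated {V : Type} (G : Digraph V) : Digraph (NonIsolated G) where
  Adj u v := G.Adj u.1 v.1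

/-- `H'` is (up to the names of the vertices) obtained from `H` by identifying terminals:
the classes of some partition of the vertex set are contracted to single vertices, after which
self-loops, parallel edges and isolated vertices are removed. -/
def IdentifiesTo (H H' : Pattern) : Prop :=
  ∃ s : Setoid (Fin H.order),
    Nonempty ((removeIsolated (quotientGraph H.graph s)).Adj ≃r H'.graph.Adj)

/-- A class of patterns is closed under identifying terminals and transitive equivalence. -/
def IsClosedClass (𝓗 : Set Pattern) : Prop :=
  (∀ H ∈ 𝓗, ∀ H', IdentifiesTo H H' → H' ∈ 𝓗) ∧ (∀ H ∈ 𝓗, ∀ H', TransEquiv H H' → H' ∈ 𝓗)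

/-- The closure of `𝓗` under identifying terminals and transitive equivalence:
the smallest closed class that contains `𝓗`. -/
def closureClass (𝓗 : Set Pattern) : Set Pattern :=
  ⋂₀ {𝓚 | 𝓗 ⊆ 𝓚 ∧ IsClosedClass 𝓚}

/-- The pattern with vertices `0, …, c.1 - 1` whose edges are the pairs in the list `c.2`
(pairs that involve a number `≥ c.1` are ignored). Every pattern has such a code. -/
def Pattern.ofCode (c : ℕ × List (ℕ × ℕ)) : Pattern where
  order := c.1
  graph := { Adj := fun i j => ((i : ℕ), (j : ℕ)) ∈ c.2 }

/-- A recursively enumerable class of patterns. -/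
def RecursivelyEnumerable (𝓗 : Set Pattern) : Prop :=
  REPred fun c : ℕ × List (ℕ × ℕ) => Pattern.ofCode c ∈ 𝓗

/-- A decidable class of patterns. -/
def DecidableClass (𝓗 : Set Pattern) : Prop :=
  ComputablePred fun c : ℕ × List (ℕ × ℕ) => Pattern.ofCode c ∈ 𝓗

/-! ### Parameterized problems and parameterized reductions -/

/-- A parameterized decision problem. Its inputs are given to machines as strings over the
alphabet `{0, 1, #}`, written `some false`, `some true` and `none`. `Valid` is the set of inputs
that are instances of the problem, and `Yes` is the set of inputs for which the question has a
positive answer. -/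
structure ParamProblem where
  Input : Type
  encode : Input → List (Option Bool)
  param : Input → ℕ
  Valid : Set Input
  Yes : Set Input

/-- The language of a parameterized problem: the instances with a positive answer. -/
def ParamProblem.language (P : ParamProblem) : Set P.Input := P.Valid ∩ P.Yes

/-- There is a parameterized reduction from `P` to `Q`: a map `r` that turns instances into
instances and preserves membership in the language in both directions, whose new parameter is
at most a computable function `g` of the old one, and which a (multi-stack) Turing machine `M`
computes in at most `f k * p n` steps on inputs of length `n` with parameter `k`, where `f` is
computable and `p` is a polynomial. -/
def ParamReducible (P Q : ParamProblem) : Prop :=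
  ∃ (r : P.Input → Q.Input) (f g : ℕ → ℕ) (p : Polynomial ℕ)
    (M : Turing.TM2ComputableAux (Option Bool) (Option Bool)),
    Computable f ∧ Computable g ∧
    (∀ x, Nonempty (Turing.TM2OutputsInTime M.tm
      ((P.encode x).map M.inputAlphabet.symm)
      (some ((Q.encode (r x)).map M.outputAlphabet.symm))
      (f (P.param x) * p.eval (P.encode x).length))) ∧
    (∀ x, Q.param (r x) ≤ g (P.param x)) ∧
    (∀ x, x ∈ P.Valid → r x ∈ Q.Valid) ∧
    (∀ x, x ∈ P.language ↔ r x ∈ Q.language)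

/-! ### Directed Steiner Network -/

/-- An input of Directed Steiner Network: a pattern `H`, an arc-weighted directed graph `G` with
vertices `0, …, size - 1` and a list `arcs` of weighted arcs (at most one arc from `u` to `v` for
each ordered pair `(u, v)`), the terminals of `G`, named injectively by the vertices of `H`,
and a budget. -/
structure Input where
  pattern : Pattern
  size : ℕ
  terminal : Fin pattern.order ↪ Fin size
  budget : ℕ
  arcs : List ((Fin size × Fin size) × ℕ)
  nodup_arcs : (arcs.map Prod.fst).Nodup

namespace Input

/-- `N` is a network that is a subgraph of `G`. -/
def IsSubnetwork (I : Input) (N : Finset ((Fin I.size × Fin I.size) × ℕ)) : Prop :=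
  ∀ a ∈ N, a ∈ I.arcs

/-- The cost of a network is the total weight of its arcs. -/
def cost (I : Input) (N : Finset ((Fin I.size × Fin I.size) × ℕ)) : ℕ :=
  ∑ a ∈ N, a.2

/-- The network `N` contains a path from `u` to `v`. -/
def HasPath (I : Input) (N : Finset ((Fin I.size × Fin I.size) × ℕ)) (u v : Fin I.size) : Prop :=
  Relation.ReflTransGen (fun x y => ∃ w, ((x, y), w) ∈ N) u v

/-- `N` is a solution: a subgraph of `G` with an `s → t` path for every edge `st` of `H`. -/
def IsSolution (I : Input) (N : Finset ((Fin I.size × Fin I.size) × ℕ)) : Prop :=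
  I.IsSubnetwork N ∧
    ∀ s t, I.pattern.graph.Adj s t → I.HasPath N (I.terminal s) (I.terminal t)

end Input

/-- A number in unary, followed by a separator. -/
def unary (n : ℕ) : List (Option Bool) :=
  List.replicate n (some true) ++ [none]

/-- A number in binary, least significant bit first, followed by a separator. -/
def binary (n : ℕ) : List (Option Bool) :=
  n.bits.map some ++ [none]

open Classical in
/-- A pattern as a string: its number of vertices in unary, then its adjacency matrix. -/
noncomputable def encodePattern (H : Pattern) : List (Option Bool) :=
  unary H.order ++
    ((List.finRange H.order).flatMap fun i =>
      (List.finRange H.order).map fun j => some (decide (H.graph.Adj i j))) ++ [none]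

/-- An input as a string. Vertices are written in unary (so the length is polynomial in the
number of vertices and arcs), weights and the budget in binary. -/
noncomputable def encodeInput (I : Input) : List (Option Bool) :=
  encodePattern I.pattern ++
    (List.finRange I.pattern.order).flatMap (fun i => unary (I.terminal i)) ++
    unary I.size ++ binary I.budget ++
    I.arcs.flatMap (fun a => unary a.1.1 ++ unary a.1.2 ++ binary a.2)

/-- The problem `𝓗`-DSN, parameterized by the number of terminals: the instances are the inputs
with a pattern from `𝓗`, and the question is whether there is a solution whose cost is at most the
budget. -/
noncomputable def problem (𝓗 : Set Pattern) : ParamProblem where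
  Input := Input
  encode := encodeInput
  param := fun I => I.pattern.order
  Valid := {I | I.pattern ∈ 𝓗}
  Yes := {I | ∃ N, I.IsSolution N ∧ I.cost N ≤ I.budget}

end DSN

/-! ### Patterns linked by a map of terminals, and the equivalent instance they give. -/

namespace DSN

open Relation

/-! Every pattern `H` in the closure comes from some `H₀ ∈ 𝓗` by a map `ψ` from the vertices of `H₀`
to those of `H` together with one extra vertex, such that the image of the edges of `H₀` and the
edges of `H` generate the same reachability (`Linked`). This relation is reflexive and transitive
and contains both closure operations (`exists_linked_of_mem_closureClass`). The extra vertex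
receives the classes that are deleted as isolated.

Given an instance for `H`, add an isolated extra vertex and, for each vertex `u` of `H₀`, a new
terminal joined in both directions by arcs of weight zero to the terminal `ψ u` or to the extra
vertex. A solution of the old instance together with all new arcs solves the new one at no extra
cost; conversely, contracting the new arcs turns a solution of the new instance into one of the old
(`Input.yes_build`, `Input.yes_of_yes_build`). Inputs whose pattern is not in `𝓗''` are sent to a
fixed instance without solution.

It remains to find `H₀` and `ψ` in time depending on `k` only. Being a correct choice is
semidecidable, so an unbounded search over certificates succeeds for every pattern in `𝓗''`, and
`𝓗''` is decidable (`exists_code_of_transforms`). The search sees only the adjacency matrix, one of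
finitely many strings of length `k * k`, so the maxima of its running time and of its output length
over these strings are computable in `k` (`exists_computable_bounds`).

To obtain a single Turing machine, the search does not output the instance, but a straight-line
program of instructions that assembles it from the terminals, the size and the budget. The machine
parses this much of the input, runs the evaluator of the search on separate stacks, and interprets
the resulting program (`steps_machine`). The arcs of the input are never parsed: they stay in place
as the tail of the output. Each instruction at most doubles the data, up to an additive constant, so
a program of length at most `L k` takes time `O(2 ^ L k)` times the input length. -/

theorem rtg_lift {α β : Type*} {r : α → α → Prop} {p : β → β → Prop} {a b : α} (f : α → β)
    (h : ∀ a b, r a b → ReflTransGen p (f a) (f b)) (hab : ReflTransGen r a b) :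
    ReflTransGen p (f a) (f b) := by
  induction hab with
  | refl => exact .refl
  | tail _ h' ih => exact ih.trans (h _ _ h')

/-! ### Linked patterns -/

/-- Solutions for `H'` are solutions for `H` after moving the terminals of `H` along a map `ψ`
(where `none` stands for an extra vertex), and vice versa. -/
def Linked (H H' : Pattern) : Prop :=
  ∃ ψ : Fin H.order → Option (Fin H'.order),
    (∀ u v, H.graph.Adj u v → ReflTransGen (Relation.Map H'.graph.Adj some some) (ψ u) (ψ v)) ∧
    (∀ a b, H'.graph.Adj a b →
      ReflTransGen (Relation.Map H.graph.Adj ψ ψ) (some a) (some b))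

theorem Linked.refl (H : Pattern) : Linked H H :=
  ⟨some, fun u v h => .single ⟨u, v, h, rfl, rfl⟩, fun u v h => .single ⟨u, v, h, rfl, rfl⟩⟩

/-- The maps are composed with `none` sent to `none`; each edge of the middle pattern is replaced by
the path that it stands for. -/
theorem Linked.trans {H₀ H₁ H₂ : Pattern} (h₁ : Linked H₀ H₁) (h₂ : Linked H₁ H₂) :
    Linked H₀ H₂ := by
  obtain ⟨ψ, hψ, hψ'⟩ := h₁
  obtain ⟨χ, hχ, hχ'⟩ := h₂
  refine ⟨fun u => (ψ u).bind χ, fun u v h => ?_, fun a b h => ?_⟩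
  · refine rtg_lift (fun x : Option (Fin H₁.order) => x.bind χ) ?_ (hψ u v h)
    rintro _ _ ⟨a, b, hab, rfl, rfl⟩
    exact hχ a b hab
  · refine ReflTransGen.trans_induction_on (hχ' a b h) (fun _ => .refl) ?_
      (fun _ _ => ReflTransGen.trans)
    rintro _ _ ⟨u, v, huv, rfl, rfl⟩
    refine rtg_lift (fun x : Option (Fin H₁.order) => x.bind χ) ?_ (hψ' u v huv)
    rintro _ _ ⟨c, d, hcd, rfl, rfl⟩
    exact .single ⟨c, d, hcd, rfl, rfl⟩

theorem TransEquiv.linked {H H' : Pattern} (h : TransEquiv H H') : Linked H H' := by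
  obtain ⟨e⟩ := h
  refine ⟨fun u => some (e u), fun u v h => ?_, fun a b h => ?_⟩
  · have : TransGen H'.graph.Adj (e u) (e v) := e.map_rel_iff.2 (TransGen.single h)
    exact rtg_lift some (fun a b h => .single ⟨a, b, h, rfl, rfl⟩) this.to_reflTransGen
  · have : TransGen H.graph.Adj (e.symm a) (e.symm b) := e.symm.map_rel_iff.2 (TransGen.single h)
    have := rtg_lift (p := Relation.Map H.graph.Adj (fun u => some (e u))
      (fun u => some (e u))) (fun u => some (e u)) (fun a b h => .single ⟨a, b, h, rfl, rfl⟩)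
      this.to_reflTransGen
    simpa using this

open Classical in
-- Edges inside a class become trivial paths, which is why `Linked` uses reflexive closures. Classes
-- that are isolated after the contraction have no counterpart in `H'` and go to `none`.
theorem IdentifiesTo.linked {H H' : Pattern} (h : IdentifiesTo H H') : Linked H H' := by
  obtain ⟨s, ⟨e⟩⟩ := h
  let G := quotientGraph H.graph s
  let χ : Quotient s → Option (Fin H'.order) := fun q =>
    if h : ∃ u, G.Adj q u ∨ G.Adj u q then some (e ⟨q, h⟩) else none
  have key : ∀ x : NonIsolated G, χ x.1 = some (e x) := fun x => dif_pos x.2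
  refine ⟨fun u => χ (Quotient.mk s u), fun u v h => ?_, fun a b h => ?_⟩
  · by_cases huv : Quotient.mk s u = Quotient.mk s v
    · simp only [huv]; exact .refl
    · have hG : G.Adj (Quotient.mk s u) (Quotient.mk s v) := ⟨huv, u, v, rfl, rfl, h⟩
      let x : NonIsolated G := ⟨Quotient.mk s u, _, .inl hG⟩
      let y : NonIsolated G := ⟨Quotient.mk s v, _, .inr hG⟩
      have : H'.graph.Adj (e x) (e y) := e.map_rel_iff.2 hG
      exact .single ⟨_, _, this, (key x).symm, (key y).symm⟩
  · have hG : G.Adj (e.symm a).1 (e.symm b).1 := e.symm.map_rel_iff.2 h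
    obtain ⟨_, u, v, hu, hv, huv⟩ := hG
    refine .single ⟨u, v, huv, ?_, ?_⟩
    · simp only [hu, key]; simp
    · simp only [hv, key]; simp

/-- The patterns linked from a member of `𝓗` form a closed class containing `𝓗`, hence contain the
smallest one. -/
theorem exists_linked_of_mem_closureClass {𝓗 : Set Pattern} {H : Pattern}
    (h : H ∈ closureClass 𝓗) : ∃ H₀ ∈ 𝓗, Linked H₀ H := by
  refine Set.mem_sInter.1 h {H | ∃ H₀ ∈ 𝓗, Linked H₀ H} ⟨fun H hH => ⟨H, hH, .refl H⟩, ?_, ?_⟩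
  · rintro H ⟨H₀, h₀, hl⟩ H' h'
    exact ⟨H₀, h₀, hl.trans h'.linked⟩
  · rintro H ⟨H₀, h₀, hl⟩ H' h'
    exact ⟨H₀, h₀, hl.trans h'.linked⟩

/-! ### Linked patterns in terms of codes -/

/-- The edges of a pattern as a relation on numbers. -/
def Pattern.edge (H : Pattern) (a b : ℕ) : Prop :=
  ∃ (ha : a < H.order) (hb : b < H.order), H.graph.Adj ⟨a, ha⟩ ⟨b, hb⟩

/-- The pairs of a list as a relation. -/
def pairRel (E : List (ℕ × ℕ)) (a b : ℕ) : Prop := (a, b) ∈ E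

/-- The pairs in the code of a pattern that are edges. -/
def codeEdges (c : ℕ × List (ℕ × ℕ)) : List (ℕ × ℕ) :=
  c.2.filter fun e => e.1 < c.1 ∧ e.2 < c.1

theorem mem_codeEdges {c : ℕ × List (ℕ × ℕ)} {a b : ℕ} :
    (a, b) ∈ codeEdges c ↔ (Pattern.ofCode c).edge a b := by
  simp only [codeEdges, Pattern.edge, Pattern.ofCode, List.mem_filter]
  simp; tauto

/-- The target of the `u`-th vertex under the map with code `ψ`, where `k` is the extra vertex. -/
def target (ψ : List ℕ) (k u : ℕ) : ℕ := min (ψ.getD u k) k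

/-- The edges of the image of a pattern under a map. -/
def imageEdges (ψ : List ℕ) (k : ℕ) (c : ℕ × List (ℕ × ℕ)) : List (ℕ × ℕ) :=
  (codeEdges c).map fun e => (target ψ k e.1, target ψ k e.2)

/-- The map with code `ψ` links the pattern with code `c₀` to the one with code `c`. -/
def CodeLinked (ψ : List ℕ) (c₀ c : ℕ × List (ℕ × ℕ)) : Prop :=
  (∀ e ∈ imageEdges ψ c.1 c₀, ReflTransGen (pairRel (codeEdges c)) e.1 e.2) ∧
    ∀ e ∈ codeEdges c, ReflTransGen (pairRel (imageEdges ψ c.1 c₀)) e.1 e.2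

theorem Linked.codeLinked {c₀ c : ℕ × List (ℕ × ℕ)}
    (h : Linked (Pattern.ofCode c₀) (Pattern.ofCode c)) : ∃ ψ, CodeLinked ψ c₀ c := by
  obtain ⟨ψ, h₁, h₂⟩ := h
  -- The extra vertex `none` becomes the number `c.1`, one past the last vertex.
  let π : Option (Fin (Pattern.ofCode c).order) → ℕ := fun x => x.elim c.1 Fin.val
  have hπ : ∀ x, π x ≤ c.1 := by
    rintro (_ | a)
    · exact le_rfl
    · exact a.2.le
  have htar : ∀ u : Fin (Pattern.ofCode c₀).order,
      target (List.ofFn fun u => π (ψ u)) c.1 u = π (ψ u) := by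
    intro u
    simp only [target, List.getD_eq_getElem?_getD, List.getElem?_ofFn, u.2, dif_pos,
      Option.getD_some]
    exact min_eq_left (hπ _)
  refine ⟨List.ofFn fun u => π (ψ u), ?_, ?_⟩
  · rintro e he
    obtain ⟨⟨u, v⟩, huv, rfl⟩ := List.mem_map.1 he
    obtain ⟨hu, hv, huv⟩ := mem_codeEdges.1 huv
    have := h₁ ⟨u, hu⟩ ⟨v, hv⟩ huv
    have := rtg_lift (p := pairRel (codeEdges c)) π ?_ this
    · rw [← htar, ← htar] at this
      exact this
    · rintro _ _ ⟨a, b, hab, rfl, rfl⟩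
      exact .single (mem_codeEdges.2 ⟨a.2, b.2, hab⟩)
  · rintro ⟨a, b⟩ he
    obtain ⟨ha, hb, hab⟩ := mem_codeEdges.1 he
    refine rtg_lift π ?_ (h₂ ⟨a, ha⟩ ⟨b, hb⟩ hab)
    rintro _ _ ⟨u, v, huv, rfl, rfl⟩
    refine .single (List.mem_map.2 ⟨(u, v), mem_codeEdges.2 ⟨u.2, v.2, huv⟩, ?_⟩)
    simp only [htar]

theorem exists_ofCode (H : Pattern) : ∃ E, Pattern.ofCode (H.order, E) = H := by
  classical
  obtain ⟨n, ⟨A⟩⟩ := H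
  refine ⟨((Finset.univ.filter fun e : Fin n × Fin n => A e.1 e.2).toList).map
    fun e => (e.1.1, e.2.1), ?_⟩
  simp only [Pattern.ofCode, Pattern.mk.injEq, heq_eq_eq, true_and, Digraph.mk.injEq]
  funext i j
  simp only [List.mem_map, Finset.mem_toList, Finset.mem_filter, Finset.mem_univ, true_and,
    Prod.mk.injEq, Prod.exists, eq_iff_iff]
  constructor
  · rintro ⟨a, b, h, ha, hb⟩
    rwa [← Fin.ext ha, ← Fin.ext hb]
  · exact fun h => ⟨i, j, h, rfl, rfl⟩

/-! ### The instance of `H`-DSN made from an instance of `H'`-DSN -/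

namespace Input

/-- The vertex at which the terminals mapped to `i` are attached. -/
def hub (I : Input) (i : ℕ) : ℕ := if h : i < I.pattern.order then I.terminal ⟨i, h⟩ else I.size

theorem hub_of_lt (I : Input) {i : ℕ} (h : i < I.pattern.order) :
    I.hub i = I.terminal ⟨i, h⟩ := dif_pos h

theorem hub_of_le (I : Input) {i : ℕ} (h : I.pattern.order ≤ i) : I.hub i = I.size :=
  dif_neg h.not_gt

theorem hub_le (I : Input) (i : ℕ) : I.hub i ≤ I.size := by
  unfold hub; split_ifs
  · exact (I.terminal _).2.le
  · exact le_rfl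

variable (I : Input) (P : Pattern) (ψ : ℕ → ℕ)

/-- An old vertex in the new graph. -/
def oldVertex (x : Fin I.size) : Fin (I.size + 1 + P.order) := ⟨x, by omega⟩

/-- The hub of `i` in the new graph. -/
def hubVertex (i : ℕ) : Fin (I.size + 1 + P.order) := ⟨I.hub i, by have := I.hub_le i; omega⟩

/-- A new terminal. -/
def newVertex (u : Fin P.order) : Fin (I.size + 1 + P.order) := ⟨I.size + 1 + u, by omega⟩

/-- The arcs of weight zero that attach the new terminals to the old ones. -/
def newArcs : List ((Fin (I.size + 1 + P.order) × Fin (I.size + 1 + P.order)) × ℕ) :=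
  (List.range (I.pattern.order + 1)).flatMap fun i =>
    ((List.finRange P.order).filter fun u : Fin P.order => ψ (u : ℕ) = i).flatMap fun u =>
      [((I.newVertex P u, I.hubVertex P i), 0), ((I.hubVertex P i, I.newVertex P u), 0)]

/-- An old arc in the new graph. -/
def oldArc (a : (Fin I.size × Fin I.size) × ℕ) :
    (Fin (I.size + 1 + P.order) × Fin (I.size + 1 + P.order)) × ℕ :=
  ((I.oldVertex P a.1.1, I.oldVertex P a.1.2), a.2)

variable {I P ψ}

/-- The list is grouped by hubs so that a machine can write it in one pass over the stack of
terminals; the correctness proof needs only this ungrouped description. -/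
theorem mem_newArcs {a} : a ∈ I.newArcs P ψ ↔ ∃ u : Fin P.order, ψ u ≤ I.pattern.order ∧
    (a = ((I.newVertex P u, I.hubVertex P (ψ u)), 0) ∨
      a = ((I.hubVertex P (ψ u), I.newVertex P u), 0)) := by
  simp only [newArcs, List.mem_flatMap, List.mem_range, List.mem_filter, List.mem_finRange,
    true_and, decide_eq_true_eq, List.mem_cons, List.not_mem_nil, or_false]
  constructor
  · rintro ⟨_, hi, u, rfl, h⟩
    exact ⟨u, by omega, h⟩
  · rintro ⟨u, hu, h⟩
    exact ⟨_, by omega, u, rfl, h⟩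

theorem oldArc_injective : Function.Injective (I.oldArc P) := by
  rintro ⟨⟨x, y⟩, w⟩ ⟨⟨x', y'⟩, w'⟩ h
  simpa [oldArc, oldVertex, Fin.ext_iff, and_assoc] using h

/-- An arc determines its new terminal and its direction, because new terminals have numbers above
`I.size` and hubs do not. -/
theorem nodup_newArcs : ((I.newArcs P ψ).map Prod.fst).Nodup := by
  simp only [newArcs, List.map_flatMap, List.map_cons, List.map_nil]
  rw [List.nodup_flatMap]
  refine ⟨fun i _ => ?_, List.nodup_range.imp_of_mem ?_⟩
  · rw [List.nodup_flatMap]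
    refine ⟨fun u _ => ?_, ((List.nodup_finRange _).filter _).imp_of_mem ?_⟩
    · have := I.hub_le i
      simp [newVertex, hubVertex, Fin.ext_iff]
      omega
    · intro u v _ _ huv
      have := I.hub_le i
      have := Fin.val_ne_of_ne huv
      simp [Function.onFun, newVertex, hubVertex, Fin.ext_iff]
      omega
  · intro i j _ _ hij
    have := I.hub_le i
    have := I.hub_le j
    simp only [Function.onFun, List.disjoint_left, List.mem_flatMap, List.mem_filter,
      List.mem_finRange, true_and, decide_eq_true_eq, List.mem_cons, List.not_mem_nil, or_false]
    rintro a ⟨u, rfl, hu⟩ ⟨v, rfl, hv⟩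
    have huv : u ≠ v := fun h => hij (by rw [h])
    have := Fin.val_ne_of_ne huv
    rcases hu with rfl | rfl <;>
    simp [newVertex, hubVertex, Fin.ext_iff] at hv <;> omega

theorem sum_image_oldArc (N : Finset ((Fin I.size × Fin I.size) × ℕ)) :
    ∑ a ∈ N.image (I.oldArc P), a.2 = ∑ a ∈ N, a.2 :=
  Finset.sum_image fun _ _ _ _ h => oldArc_injective h

variable (I P ψ)

/-- The new instance. -/
def build : Input where
  pattern := P
  size := I.size + 1 + P.order
  terminal := ⟨I.newVertex P, fun u v h => by simpa [newVertex, Fin.ext_iff] using h⟩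
  budget := I.budget
  arcs := I.newArcs P ψ ++ I.arcs.map (I.oldArc P)
  nodup_arcs := by
    rw [List.map_append, List.nodup_append]
    refine ⟨nodup_newArcs, ?_, ?_⟩
    · have : (I.arcs.map (I.oldArc P)).map Prod.fst =
          (I.arcs.map Prod.fst).map fun a => (I.oldVertex P a.1, I.oldVertex P a.2) := by
        simp [oldArc]
      rw [this]
      refine I.nodup_arcs.map ?_
      rintro ⟨x, y⟩ ⟨x', y'⟩ h
      simpa [oldVertex, Fin.ext_iff] using h
    · intro a ha b hb
      rw [List.mem_map] at ha hb
      obtain ⟨a, ha, rfl⟩ := ha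
      obtain ⟨b, hb, rfl⟩ := hb
      obtain ⟨b, hb, rfl⟩ := List.mem_map.1 hb
      obtain ⟨u, _, rfl | rfl⟩ := mem_newArcs.1 ha <;>
      simp [oldArc, oldVertex, newVertex, hubVertex, Fin.ext_iff] <;> omega

variable {I P ψ}

/-- The adjacency of vertices in a network, as a relation on numbers. -/
def netRel (I : Input) (N : Finset ((Fin I.size × Fin I.size) × ℕ)) (x y : ℕ) : Prop :=
  ∃ (hx : x < I.size) (hy : y < I.size), ∃ w, ((⟨x, hx⟩, ⟨y, hy⟩), w) ∈ N

/-- Vertices are treated as numbers from here on, so that paths in the old and the new graph can be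
compared without coercions between different `Fin` types. -/
theorem hasPath_iff {N : Finset ((Fin I.size × Fin I.size) × ℕ)} {x y : Fin I.size} :
    I.HasPath N x y ↔ ReflTransGen (I.netRel N) x y := by
  constructor
  · exact rtg_lift Fin.val fun a b ⟨w, h⟩ => .single ⟨a.2, b.2, w, h⟩
  · intro h
    suffices ∀ z : ℕ, ReflTransGen (I.netRel N) x z → ∀ hz : z < I.size, I.HasPath N x ⟨z, hz⟩ from
      this _ h y.2
    intro z hz
    induction hz with
    | refl => exact fun _ => .refl
    | tail _ h ih =>
      obtain ⟨hx, hy, w, hw⟩ := h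
      exact fun _ => (ih hx).tail ⟨w, hw⟩

theorem isSolution_iff {N : Finset ((Fin I.size × Fin I.size) × ℕ)} :
    I.IsSolution N ↔ I.IsSubnetwork N ∧
      ∀ a b, I.pattern.edge a b → ReflTransGen (I.netRel N) (I.hub a) (I.hub b) := by
  refine and_congr_right fun _ => ⟨?_, ?_⟩
  · rintro h a b ⟨ha, hb, hab⟩
    rw [hub_of_lt I ha, hub_of_lt I hb]
    exact hasPath_iff.1 (h _ _ hab)
  · intro h a b hab
    rw [hasPath_iff]
    have := h a b ⟨a.2, b.2, hab⟩
    rwa [hub_of_lt I a.2, hub_of_lt I b.2] at this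

theorem build_hub (u : Fin P.order) : (I.build P ψ).hub u = I.size + 1 + u :=
  hub_of_lt _ (i := u) u.2

theorem mem_build_arcs {a} : a ∈ (I.build P ψ).arcs ↔
    a ∈ I.newArcs P ψ ∨ ∃ b ∈ I.arcs, I.oldArc P b = a := by
  refine List.mem_append.trans (or_congr_right ?_)
  exact List.mem_map

/-- The image of the edges of `P` under `ψ`. -/
def imageRel (P : Pattern) (ψ : ℕ → ℕ) (x y : ℕ) : Prop :=
  ∃ u v, P.edge u v ∧ ψ u = x ∧ ψ v = y

/-- All new arcs are bought, for free. A demand `u → v` is met by going from `u` to its hub,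
following old paths to the hub of `v`, and leaving to `v`. -/
theorem yes_build (hψ : ∀ u, ψ u ≤ I.pattern.order)
    (h : ∀ u v, P.edge u v → ReflTransGen I.pattern.edge (ψ u) (ψ v))
    (hyes : ∃ N, I.IsSolution N ∧ I.cost N ≤ I.budget) :
    ∃ N, (I.build P ψ).IsSolution N ∧ (I.build P ψ).cost N ≤ (I.build P ψ).budget := by
  classical
  obtain ⟨N, hN, hc⟩ := hyes
  rw [isSolution_iff] at hN
  obtain ⟨hsub, hN⟩ := hN
  let A : Finset ((Fin (I.build P ψ).size × Fin (I.build P ψ).size) × ℕ) :=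
    (I.newArcs P ψ).toFinset
  let B : Finset ((Fin (I.build P ψ).size × Fin (I.build P ψ).size) × ℕ) :=
    N.image (I.oldArc P)
  refine ⟨A ∪ B, isSolution_iff.2 ⟨fun a ha => ?_, fun u v huv => ?_⟩, ?_⟩
  · rcases Finset.mem_union.1 ha with ha | ha
    · exact mem_build_arcs.2 (.inl (List.mem_toFinset.1 ha))
    · obtain ⟨b, hb, rfl⟩ := Finset.mem_image.1 ha
      exact mem_build_arcs.2 (.inr ⟨b, hsub b hb, rfl⟩)
  · have hB : ∀ x y, ReflTransGen (I.netRel N) x y →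
        ReflTransGen ((I.build P ψ).netRel (A ∪ B)) x y := by
      intro x y
      refine rtg_lift id ?_
      rintro x y ⟨hx, hy, w, hw⟩
      exact .single ⟨(I.oldVertex P ⟨x, hx⟩).2, (I.oldVertex P ⟨y, hy⟩).2, w,
        Finset.mem_union_right _ (Finset.mem_image.2 ⟨_, hw, rfl⟩)⟩
    obtain ⟨hu, hv, _⟩ := id huv
    have e₁ : ReflTransGen ((I.build P ψ).netRel (A ∪ B)) ((I.build P ψ).hub u)
        (I.hub (ψ u)) := by
      rw [show (I.build P ψ).hub u = _ from build_hub ⟨u, hu⟩]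
      exact .single ⟨(I.newVertex P ⟨u, hu⟩).2, (I.hubVertex P (ψ u)).2, 0,
        Finset.mem_union_left _ (List.mem_toFinset.2 (mem_newArcs.2
          ⟨⟨u, hu⟩, hψ u, .inl rfl⟩))⟩
    have e₂ : ReflTransGen ((I.build P ψ).netRel (A ∪ B)) (I.hub (ψ v))
        ((I.build P ψ).hub v) := by
      rw [show (I.build P ψ).hub v = _ from build_hub ⟨v, hv⟩]
      exact .single ⟨(I.hubVertex P (ψ v)).2, (I.newVertex P ⟨v, hv⟩).2, 0,
        Finset.mem_union_left _ (List.mem_toFinset.2 (mem_newArcs.2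
          ⟨⟨v, hv⟩, hψ v, .inr rfl⟩))⟩
    exact (e₁.trans (hB _ _ (rtg_lift I.hub hN (h u v huv)))).trans e₂
  · calc (I.build P ψ).cost (A ∪ B) ≤ (∑ a ∈ A, a.2) + ∑ a ∈ B, a.2 := by
          rw [← Finset.sum_union_inter]; exact Nat.le_add_right _ _
      _ = ∑ a ∈ N, a.2 := by
          rw [show ∑ a ∈ B, a.2 = _ from sum_image_oldArc N, Finset.sum_eq_zero, zero_add]
          · intro a ha
            obtain ⟨u, _, rfl | rfl⟩ := mem_newArcs.1 (List.mem_toFinset.1 ha) <;> rfl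
      _ ≤ I.budget := hc

/-- The vertex of the old graph with which a vertex of the new graph is merged when the new arcs
are contracted. -/
def contract (I : Input) (ψ : ℕ → ℕ) (x : ℕ) : ℕ :=
  if x ≤ I.size then x else I.hub (ψ (x - (I.size + 1)))

/-- Under `contract` new arcs become trivial and old arcs stay, so every path of `N` becomes a path
in the old part `N'` of `N`. A demand of the old pattern is a chain of images of demands of `P`. -/
theorem yes_of_yes_build
    (h : ∀ a b, I.pattern.edge a b → ReflTransGen (imageRel P ψ) a b)
    (hyes : ∃ N, (I.build P ψ).IsSolution N ∧ (I.build P ψ).cost N ≤ (I.build P ψ).budget) :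
    ∃ N, I.IsSolution N ∧ I.cost N ≤ I.budget := by
  classical
  obtain ⟨N, hN, hc⟩ := hyes
  rw [isSolution_iff] at hN
  obtain ⟨hsub, hN⟩ := hN
  let N' : Finset ((Fin I.size × Fin I.size) × ℕ) := I.arcs.toFinset.filter fun a => I.oldArc P a ∈ N
  refine ⟨N', isSolution_iff.2 ⟨fun a ha => ?_, fun a b hab => ?_⟩, ?_⟩
  · exact List.mem_toFinset.1 (Finset.mem_filter.1 ha).1
  · refine rtg_lift I.hub ?_ (h a b hab)
    rintro _ _ ⟨u, v, huv, rfl, rfl⟩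
    have key := rtg_lift (p := I.netRel N') (I.contract ψ) ?_ (hN u v huv)
    · obtain ⟨hu, hv, _⟩ := huv
      rw [show (I.build P ψ).hub u = _ from build_hub ⟨u, hu⟩,
        show (I.build P ψ).hub v = _ from build_hub ⟨v, hv⟩] at key
      have : ∀ w, I.contract ψ (I.size + 1 + w) = I.hub (ψ w) := by
        intro w
        rw [contract, if_neg (by omega), Nat.add_sub_cancel_left]
      rwa [this, this] at key
    · have hh : ∀ u : Fin P.order, I.contract ψ (I.newVertex P u) = I.hub (ψ u) := by
        intro u
        rw [contract, if_neg (by simp [newVertex]; omega)]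
        simp [newVertex]
      have hh' : ∀ i, I.contract ψ (I.hubVertex P i) = I.hub i := fun i => if_pos (I.hub_le i)
      rintro x y ⟨hx, hy, w, hw⟩
      rcases mem_build_arcs.1 (hsub _ hw) with ha | ⟨⟨⟨x', y'⟩, w'⟩, hb, hb'⟩
      · obtain ⟨u, _, ha | ha⟩ := mem_newArcs.1 ha
        all_goals
          have h₁ : x = _ := congrArg (fun a => (a.1.1 : ℕ)) ha
          have h₂ : y = _ := congrArg (fun a => (a.1.2 : ℕ)) ha
          simp only at h₁ h₂
          rw [h₁, h₂, hh, hh']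
      · have hb'' := hb'
        have h₁ : (x' : ℕ) = x := congrArg (fun a => (a.1.1 : ℕ)) hb'
        have h₂ : (y' : ℕ) = y := congrArg (fun a => (a.1.2 : ℕ)) hb'
        subst h₁ h₂
        rw [contract, contract, if_pos x'.2.le, if_pos y'.2.le]
        exact .single ⟨x'.2, y'.2, w', Finset.mem_filter.2 ⟨List.mem_toFinset.2 hb, hb'' ▸ hw⟩⟩
  · refine le_trans ?_ hc
    calc I.cost N' = ∑ a ∈ N'.image (I.oldArc P), a.2 :=
          (sum_image_oldArc N').symm
      _ ≤ (I.build P ψ).cost N := by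
          refine Finset.sum_le_sum_of_subset fun a ha => ?_
          obtain ⟨b, hb, rfl⟩ := Finset.mem_image.1 ha
          exact (Finset.mem_filter.1 hb).2

end Input

theorem CodeLinked.yes_iff {ψ : List ℕ} {c₀ c : ℕ × List (ℕ × ℕ)} (h : CodeLinked ψ c₀ c)
    {I : Input} (hI : I.pattern = Pattern.ofCode c) :
    (∃ N, I.IsSolution N ∧ I.cost N ≤ I.budget) ↔
    ∃ N, (I.build (Pattern.ofCode c₀) (target ψ c.1)).IsSolution N ∧
      (I.build (Pattern.ofCode c₀) (target ψ c.1)).cost N ≤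
        (I.build (Pattern.ofCode c₀) (target ψ c.1)).budget := by
  have ho : I.pattern.order = c.1 := by rw [hI]; rfl
  have he : I.pattern.edge = pairRel (codeEdges c) := by
    rw [hI]; funext a b; exact propext mem_codeEdges.symm
  have hi : Input.imageRel (Pattern.ofCode c₀) (target ψ c.1) =
      pairRel (imageEdges ψ c.1 c₀) := by
    funext a b
    simp [Input.imageRel, pairRel, imageEdges, mem_codeEdges]
  refine ⟨Input.yes_build (fun u => ho ▸ min_le_right _ _) fun u v huv => ?_,
    Input.yes_of_yes_build fun a b hab => ?_⟩
  · rw [he]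
    exact h.1 _ (List.mem_map.2 ⟨(u, v), mem_codeEdges.2 huv, rfl⟩)
  · rw [hi]
    rw [he] at hab
    exact h.2 _ hab

end DSN

/-! ### Evaluating a recursive function on a stack machine, with computable bounds. -/

namespace DSN

open Turing PartrecToTM2

/-! ### Counting steps -/

/-- `f` leads from `a` to `b` in `n` steps. -/
inductive StepsTo {α : Type*} (f : α → Option α) : ℕ → α → α → Prop
  | refl (a : α) : StepsTo f 0 a a
  | head {n : ℕ} {a b c : α} (h : f a = some b) (h' : StepsTo f n b c) : StepsTo f (n + 1) a c

namespace StepsTo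

variable {α : Type*} {f : α → Option α} {a b c : α} {m n : ℕ}

theorem trans (h : StepsTo f m a b) (h' : StepsTo f n b c) : StepsTo f (m + n) a c := by
  induction h with
  | refl => rwa [Nat.zero_add]
  | head h _ ih => rw [Nat.add_right_comm]; exact .head h (ih h')

theorem single (h : f a = some b) : StepsTo f 1 a b := .head h (.refl b)

theorem iterate_eq (h : StepsTo f n a b) : (flip bind f)^[n] (some a) = some b := by
  induction h with
  | refl => rfl
  | head h _ ih => 
    rw [Function.iterate_succ_apply]
    refine Eq.trans (congrArg _ ?_) ih
    exact h

theorem exists_of_reaches (h : StateTransition.Reaches f a b) : ∃ n, StepsTo f n a b := by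
  induction h using Relation.ReflTransGen.head_induction_on with
  | refl => exact ⟨0, .refl b⟩
  | head h _ ih => exact ⟨_, .head h ih.choose_spec⟩

/-- Letting halted configurations stay put makes a run a plain iteration of a total function, which
primitive recursion can express. -/
theorem iterate_getD_eq (h : StepsTo f n a b) : (fun a => (f a).getD a)^[n] a = b := by
  induction h with
  | refl => rfl
  | head h _ ih => rw [Function.iterate_succ_apply, h]; exact ih

/-- A computation that is still running has taken fewer steps than one that has halted. -/
theorem le_of_iterate_eq_none (h : StepsTo f n a b) (hm : f ((fun a => (f a).getD a)^[m] a) = none) :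
    n ≤ m := by
  induction h generalizing m with
  | refl => exact m.zero_le
  | head h _ ih =>
    cases m with
    | zero => simp [h] at hm
    | succ m =>
      rw [Function.iterate_succ_apply, h] at hm
      exact Nat.succ_le_succ (ih hm)

theorem iterate_eq_of_le (h : StepsTo f n a b) (hb : f b = none) (hm : n ≤ m) :
    (fun a => (f a).getD a)^[m] a = b := by
  obtain ⟨d, rfl⟩ := Nat.exists_eq_add_of_le hm
  rw [Nat.add_comm, Function.iterate_add_apply, h.iterate_getD_eq]
  exact Function.iterate_fixed (by simp [hb]) d

end StepsTo

/-! ### Restricting the labels of a machine to a supporting set -/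

section restrict

variable {K : Type*} {Γ : K → Type*} {Λ σ : Type*} [DecidableEq Λ]

/-- The statement with labels in `S` obtained by sending the labels outside `S` to `d`. -/
def restrictStmt (S : Finset Λ) (d : S) : TM2.Stmt Γ Λ σ → TM2.Stmt Γ S σ
  | .push k f q => .push k f (restrictStmt S d q)
  | .peek k f q => .peek k f (restrictStmt S d q)
  | .pop k f q => .pop k f (restrictStmt S d q)
  | .load f q => .load f (restrictStmt S d q)
  | .branch f q₁ q₂ => .branch f (restrictStmt S d q₁) (restrictStmt S d q₂)
  | .goto l => .goto fun v => if h : l v ∈ S then ⟨l v, h⟩ else d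
  | .halt => .halt

/-- Forget that a label lies in `S`. -/
def forgetCfg {S : Finset Λ} (c : TM2.Cfg Γ S σ) : TM2.Cfg Γ Λ σ :=
  ⟨c.l.map Subtype.val, c.var, c.stk⟩

variable [DecidableEq K]

/-- The evaluator `tr` has infinitely many labels, but a Turing machine may have only finitely many.
The default `d` is never reached, since a supported statement jumps only within `S`. -/
theorem stepAux_restrictStmt {S : Finset Λ} (d : S) (q : TM2.Stmt Γ Λ σ)
    (hq : TM2.SupportsStmt S q) (v : σ) (T : ∀ k, List (Γ k)) :
    forgetCfg (TM2.stepAux (restrictStmt S d q) v T) = TM2.stepAux q v T := by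
  induction q generalizing v T with
  | branch f q₁ q₂ ih₁ ih₂ =>
    simp only [restrictStmt, TM2.stepAux]
    cases f v
    · exact ih₂ hq.2 _ _
    · exact ih₁ hq.1 _ _
  | goto l =>
    have : l v ∈ S := hq v
    simp [restrictStmt, forgetCfg, this]
  | halt => rfl
  | _ => rename_i ih; exact ih hq _ _

theorem step_restrictStmt {S : Finset Λ} (d : S) (M : Λ → TM2.Stmt Γ Λ σ)
    (hM : ∀ q ∈ S, TM2.SupportsStmt S (M q)) (c : TM2.Cfg Γ S σ) :
    (TM2.step (fun q : S => restrictStmt S d (M q)) c).map forgetCfg =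
      TM2.step M (forgetCfg c) := by
  obtain ⟨_ | l, v, T⟩ := c
  · rfl
  · exact congrArg some (stepAux_restrictStmt d _ (hM l l.2) v T)

theorem reaches_restrictStmt {S : Finset Λ} (d : S) (M : Λ → TM2.Stmt Γ Λ σ)
    (hM : ∀ q ∈ S, TM2.SupportsStmt S (M q)) (c : TM2.Cfg Γ S σ) (b : TM2.Cfg Γ Λ σ)
    (h : StateTransition.Reaches (TM2.step M) (forgetCfg c) b) :
    ∃ b', forgetCfg b' = b ∧
      StateTransition.Reaches (TM2.step fun q : S => restrictStmt S d (M q)) c b' := by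
  induction h with
  | refl => exact ⟨c, rfl, .refl⟩
  | tail _ h ih =>
    obtain ⟨b', rfl, hb⟩ := ih
    rw [← step_restrictStmt d M hM] at h
    obtain ⟨b'', h', rfl⟩ := Option.map_eq_some_iff.1 h
    exact ⟨b'', rfl, hb.tail h'⟩

end restrict

/-! ### Machines with four stacks over `Γ'` have primitive recursive step functions -/

noncomputable instance : Primcodable Γ' := Primcodable.ofEquiv _ (Fintype.equivFin Γ')

/-- The contents of four stacks. -/
abbrev FourStacks := List Γ' × List Γ' × List Γ' × List Γ'

/-- Four stacks as a function. -/
def FourStacks.fn (t : FourStacks) : K' → List Γ' := K'.elim t.1 t.2.1 t.2.2.1 t.2.2.2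

/-- Change one of four stacks. -/
def FourStacks.set (t : FourStacks) (k : K') (l : List Γ') : FourStacks :=
  match k with
  | .main => (l, t.2.1, t.2.2.1, t.2.2.2)
  | .rev => (t.1, l, t.2.2.1, t.2.2.2)
  | .aux => (t.1, t.2.1, l, t.2.2.2)
  | .stack => (t.1, t.2.1, t.2.2.1, l)

theorem FourStacks.fn_set (t : FourStacks) (k : K') (l : List Γ') :
    (t.set k l).fn = Function.update t.fn k l := by
  cases k <;> simp [fn, set]

open Primrec in
theorem FourStacks.primrec_fn (k : K') : Primrec fun t : FourStacks => t.fn k := by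
  cases k
  · exact fst
  · exact fst.comp snd
  · exact fst.comp (snd.comp snd)
  · exact snd.comp (snd.comp snd)

open Primrec in
theorem FourStacks.primrec_set (k : K') :
    Primrec₂ fun (t : FourStacks) (l : List Γ') => t.set k l := by
  have h₁ : Primrec fun p : FourStacks × List Γ' => p.1.1 := fst.comp fst
  have h₂ : Primrec fun p : FourStacks × List Γ' => p.1.2.1 := fst.comp (snd.comp fst)
  have h₃ : Primrec fun p : FourStacks × List Γ' => p.1.2.2.1 :=
    fst.comp (snd.comp (snd.comp fst))
  have h₄ : Primrec fun p : FourStacks × List Γ' => p.1.2.2.2 :=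
    snd.comp (snd.comp (snd.comp fst))
  cases k
  · exact snd.pair (h₂.pair (h₃.pair h₄))
  · exact h₁.pair (snd.pair (h₃.pair h₄))
  · exact h₁.pair (h₂.pair (snd.pair h₄))
  · exact h₁.pair (h₂.pair (h₃.pair snd))

/-- A configuration as a tuple. -/
abbrev TupleCfg (Λ : Type) := Option Λ × Option Γ' × FourStacks

/-- The configuration given by a tuple. -/
def TupleCfg.toCfg {Λ : Type} (c : TupleCfg Λ) : TM2.Cfg (fun _ : K' => Γ') Λ (Option Γ') :=
  ⟨c.1, c.2.1, c.2.2.fn⟩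

section

variable {Λ : Type} [Primcodable Λ]

open Primrec in
-- All functions in a statement have finite domains, hence are primitive recursive, and the stacks
-- are touched only at their tops.
theorem exists_primrec_stepAux (q : TM2.Stmt (fun _ : K' => Γ') Λ (Option Γ')) :
    ∃ g : Option Γ' × FourStacks → TupleCfg Λ, Primrec g ∧
      ∀ x, (g x).toCfg = TM2.stepAux q x.1 x.2.fn := by
  induction q with
  | push k f q ih =>
    obtain ⟨g, hg, h⟩ := ih
    refine ⟨fun x => g (x.1, x.2.set k (f x.1 :: x.2.fn k)), hg.comp (fst.pair
      ((FourStacks.primrec_set k).comp snd (list_cons.comp ((dom_finite f).comp fst)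
        ((FourStacks.primrec_fn k).comp snd)))), fun x => ?_⟩
    rw [h, FourStacks.fn_set]; rfl
  | peek k f q ih =>
    obtain ⟨g, hg, h⟩ := ih
    refine ⟨fun x => g (f x.1 (x.2.fn k).head?, x.2), hg.comp (.pair
      ((dom_finite fun p : Option Γ' × Option Γ' => f p.1 p.2).comp (fst.pair
        (list_head?.comp ((FourStacks.primrec_fn k).comp snd)))) snd), fun x => ?_⟩
    rw [h]; rfl
  | pop k f q ih =>
    obtain ⟨g, hg, h⟩ := ih
    refine ⟨fun x => g (f x.1 (x.2.fn k).head?, x.2.set k (x.2.fn k).tail), hg.comp (.pair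
      ((dom_finite fun p : Option Γ' × Option Γ' => f p.1 p.2).comp (fst.pair
        (list_head?.comp ((FourStacks.primrec_fn k).comp snd))))
      ((FourStacks.primrec_set k).comp snd
        (list_tail.comp ((FourStacks.primrec_fn k).comp snd)))), fun x => ?_⟩
    rw [h, FourStacks.fn_set]; rfl
  | load f q ih =>
    obtain ⟨g, hg, h⟩ := ih
    refine ⟨fun x => g (f x.1, x.2), hg.comp (.pair ((dom_finite f).comp fst) snd), fun x => ?_⟩
    rw [h]; rfl
  | branch f q₁ q₂ ih₁ ih₂ =>
    obtain ⟨g₁, hg₁, h₁⟩ := ih₁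
    obtain ⟨g₂, hg₂, h₂⟩ := ih₂
    refine ⟨fun x => cond (f x.1) (g₁ x) (g₂ x), cond ((dom_finite f).comp fst) hg₁ hg₂,
      fun x => ?_⟩
    simp only [TM2.stepAux]
    cases f x.1
    · exact h₂ x
    · exact h₁ x
  | goto f =>
    exact ⟨fun x => (some (f x.1), x.1, x.2), (option_some.comp ((dom_finite f).comp fst)).pair
      (fst.pair snd), fun x => rfl⟩
  | halt => exact ⟨fun x => (none, x.1, x.2), (const none).pair (fst.pair snd), fun x => rfl⟩

open Primrec in
-- A finite case distinction, built up along a list of all values of the first argument.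
theorem primrec₂_of_finite {α β σ : Type*} [Finite α] [Primcodable α] [Primcodable β]
    [Primcodable σ] {g : α → β → σ} (hg : ∀ a, Primrec (g a)) : Primrec₂ g := by
  classical
  rcases isEmpty_or_nonempty α with h | ⟨⟨a₀⟩⟩
  · exact (dom_finite (fun p : α × β => (isEmptyElim p.1 : σ))).of_eq fun p => isEmptyElim p.1
  · obtain ⟨l, _, hl⟩ := Finite.exists_univ_list α
    suffices ∀ l : List α, ∃ h : α → β → σ, Primrec₂ h ∧ ∀ a ∈ l, h a = g a by
      obtain ⟨h, h₁, h₂⟩ := this l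
      rwa [funext fun a => h₂ a (hl a)] at h₁
    intro l
    induction l with
    | nil => exact ⟨fun _ => g a₀, (hg a₀).comp snd, by simp⟩
    | cons b l ih =>
      obtain ⟨h, h₁, h₂⟩ := ih
      refine ⟨fun a x => if a = b then g b x else h a x,
        ite (Primrec.eq.comp fst (const b)) ((hg b).comp snd) h₁, fun a ha => ?_⟩
      by_cases hab : a = b
      · simp [hab]
      · simp [hab, h₂ a ((List.mem_cons.1 ha).resolve_left hab)]

open Primrec in
theorem exists_primrec_step [Finite Λ] (M : Λ → TM2.Stmt (fun _ : K' => Γ') Λ (Option Γ')) :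
    ∃ g : TupleCfg Λ → TupleCfg Λ, Primrec g ∧
      ∀ c, (g c).toCfg = (TM2.step M c.toCfg).getD c.toCfg := by
  choose g hg h using fun l => exists_primrec_stepAux (M l)
  refine ⟨fun c => Option.casesOn c.1 c fun l => g l c.2,
    option_casesOn (f := fun c => c) (g := fun c l => g l c.2) fst .id
    ((primrec₂_of_finite hg).comp snd (snd.comp fst)).to₂, ?_⟩
  rintro ⟨_ | l, x⟩
  · rfl
  · exact h l x

end

/-! ### Binary strings -/

/-- The binary digits of a number without the leading one, least significant digit first. -/
def bitsToNat (l : List Bool) : ℕ := l.foldr (fun b n => 2 * n + cond b 1 0) 1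

/-- A binary digit as a symbol of the machine. -/
def bitSymbol (b : Bool) : Γ' := cond b .bit1 .bit0

/-- The implicit leading one preserves zeros at the end of the string and makes the number of a
string, on the stack, the string itself followed by a fixed symbol. -/
theorem trNat_bitsToNat (l : List Bool) : trNat (bitsToNat l) = l.map bitSymbol ++ [.bit1] := by
  suffices ∃ p : PosNum, (p : ℕ) = bitsToNat l ∧ trPosNum p = l.map bitSymbol ++ [.bit1] by
    obtain ⟨p, hp, h⟩ := this
    rw [trNat, ← hp, PosNum.of_to_nat]
    exact h
  induction l with
  | nil => exact ⟨1, rfl, rfl⟩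
  | cons b l ih =>
    obtain ⟨p, hp, h⟩ := ih
    cases b
    · exact ⟨p.bit0, by simp [bitsToNat] at hp ⊢; omega, by simp [trPosNum, h, bitSymbol]⟩
    · exact ⟨p.bit1, by simp [bitsToNat] at hp ⊢; omega, by simp [trPosNum, h, bitSymbol]⟩

theorem bitsToNat_injective : Function.Injective bitsToNat := by
  intro l l' h
  have := congrArg trNat h
  rw [trNat_bitsToNat, trNat_bitsToNat, List.append_left_inj] at this
  refine List.map_injective_iff.2 ?_ this
  intro b b'
  cases b <;> cases b' <;> simp [bitSymbol]

open Primrec in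
theorem primrec_bitsToNat : Primrec bitsToNat :=
  list_foldr .id (const 1) (nat_add.comp (nat_mul.comp (const 2) (snd.comp snd))
    ((dom_finite fun b : Bool => cond b 1 0).comp (fst.comp snd))).to₂

/-- All binary strings of a given length. -/
def allStrings (n : ℕ) : List (List Bool) :=
  n.rec [[]] fun _ L => L.map (List.cons true) ++ L.map (List.cons false)

theorem mem_allStrings {n : ℕ} {l : List Bool} : l ∈ allStrings n ↔ l.length = n := by
  induction n generalizing l with
  | zero => simp [allStrings]
  | succ n ih =>
    change l ∈ (allStrings n).map _ ++ (allStrings n).map _ ↔ _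
    rcases l with _ | ⟨_ | _, l⟩ <;> simp [ih]

open Primrec in
theorem primrec_allStrings : Primrec allStrings :=
  nat_rec₁ _ (list_append.comp (list_map snd (list_cons.comp (const true) snd).to₂)
    (list_map snd (list_cons.comp (const false) snd).to₂)).to₂

/-! ### The machine that evaluates a code -/

section evaluator

variable (c : ToPartrec.Code)

/-- The labels of the machine. -/
abbrev EvalLabel := { q // q ∈ codeSupp c Cont'.halt }

/-- The initial label of the machine. -/
def evalStart : EvalLabel c :=
  ⟨trNormal c Cont'.halt, codeSupp_self _ _ (trStmts₁_self _)⟩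

/-- The program of the machine. -/
def evalProgram (q : EvalLabel c) : TM2.Stmt (fun _ : K' => Γ') (EvalLabel c) (Option Γ') :=
  restrictStmt _ (evalStart c) (tr q)

/-- The initial configuration on the number with digits `l`. -/
def evalInit (l : List Bool) : TupleCfg (EvalLabel c) :=
  (some (evalStart c), none, l.map bitSymbol ++ [.bit1, .cons], [], [], [])

/-- The halting configuration with output `v`. -/
def evalHalt (v : List ℕ) : TupleCfg (EvalLabel c) := (none, none, trList v, [], [], [])

theorem exists_stepsTo_evalHalt {l : List Bool} {v : List ℕ} (hv : v ∈ c.eval [bitsToNat l]) :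
    ∃ n, StepsTo (TM2.step (evalProgram c)) n (evalInit c l).toCfg (evalHalt c v).toCfg := by
  have h : halt v ∈ StateTransition.eval (TM2.step tr) (init c [bitsToNat l]) := by
    rw [tr_eval]
    exact Part.mem_map halt hv
  have hi : forgetCfg (evalInit c l).toCfg = init c [bitsToNat l] := by
    simp only [forgetCfg, evalInit, TupleCfg.toCfg, init, evalStart, FourStacks.fn, trList,
      trNat_bitsToNat]
    simp
  obtain ⟨⟨o, x, T⟩, hb, hr⟩ := reaches_restrictStmt (evalStart c) tr
    (tr_supports c Cont'.halt).2 (evalInit c l).toCfg (halt v)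
    (hi ▸ (StateTransition.mem_eval.1 h).1)
  obtain ⟨n, hn⟩ := StepsTo.exists_of_reaches hr
  refine ⟨n, ?_⟩
  have hb' := hb
  simp only [forgetCfg, halt, TM2.Cfg.mk.injEq, Option.map_eq_none_iff] at hb'
  obtain ⟨rfl, rfl, rfl⟩ := hb'
  exact hn

open Primrec in
/-- The running time and the length of the output of the machine on strings of length `k * k` are
bounded by computable functions of `k`. -/
theorem exists_computable_bounds
    (h : ∀ l : List Bool, (∃ k, l.length = k * k) → (c.eval [bitsToNat l]).Dom) :
    ∃ T L : ℕ → ℕ, Computable T ∧ Computable L ∧ ∀ k l, l.length = k * k →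
      ∀ v ∈ c.eval [bitsToNat l], (trList v).length ≤ L k ∧ ∃ n ≤ T k,
        StepsTo (TM2.step (evalProgram c)) n (evalInit c l).toCfg (evalHalt c v).toCfg := by
  classical
  let _ : Primcodable (EvalLabel c) := Primcodable.ofEquiv _ (Fintype.equivFin (EvalLabel c))
  obtain ⟨g, hg, hgs⟩ := exists_primrec_step (evalProgram c)
  have hit : ∀ n x, ((g^[n]) x).toCfg =
      (fun a => (TM2.step (evalProgram c) a).getD a)^[n] x.toCfg := by
    intro n
    induction n with
    | zero => exact fun x => rfl
    | succ n ih => intro x; rw [Function.iterate_succ_apply, ih, hgs, Function.iterate_succ_apply]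
  have hstep : ∀ x : TupleCfg (EvalLabel c),
      TM2.step (evalProgram c) x.toCfg = none ↔ x.1 = none := by
    rintro ⟨_ | _, _⟩ <;> simp [TupleCfg.toCfg, TM2.step]
  have hinit : Primrec (evalInit c) :=
    (const _).pair ((const _).pair ((list_append.comp (list_map .id ((dom_finite _).comp snd).to₂)
      (const _)).pair (const _)))
  -- `P k s` says that within `s` steps the machine has halted on all strings of length `k * k`. It
  -- is decidable since there are finitely many; the least such `s` is the time bound.
  let P : ℕ → ℕ → Prop := fun k s => ∀ l ∈ allStrings (k * k), (g^[s] (evalInit c l)).1 = none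
  have hP : PrimrecPred fun p : ℕ × ℕ => P p.1 p.2 := by
    have : PrimrecRel fun (l : List Bool) (s : ℕ) => (g^[s] (evalInit c l)).1 = none :=
      Primrec.eq.comp (fst.comp (nat_iterate snd (hinit.comp fst) (hg.comp snd).to₂)) (const none)
    exact this.forall_mem_list.comp (primrec_allStrings.comp (nat_mul.comp fst fst)) snd
  have hs : ∀ k l, l.length = k * k → ∃ n v, v ∈ c.eval [bitsToNat l] ∧
      StepsTo (TM2.step (evalProgram c)) n (evalInit c l).toCfg (evalHalt c v).toCfg := by
    intro k l hl
    obtain ⟨v, hv⟩ := Part.dom_iff_mem.1 (h l ⟨k, hl⟩)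
    exact ⟨_, v, hv, (exists_stepsTo_evalHalt c hv).choose_spec⟩
  have hex : ∀ k, ∃ s, P k s := by
    intro k
    have : ∀ l, ∃ n, l.length = k * k → ∀ m ≥ n, (g^[m] (evalInit c l)).1 = none := by
      intro l
      by_cases hl : l.length = k * k
      · obtain ⟨n, v, _, hn⟩ := hs k l hl
        refine ⟨n, fun _ m hm => ?_⟩
        rw [← hstep, hit, hn.iterate_eq_of_le ((hstep _).2 rfl) hm]
        rfl
      · exact ⟨0, fun h => absurd h hl⟩
    choose n hn using this
    -- A sum serves as an upper bound for the maximum, here and in the bound for the output length.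
    refine ⟨((allStrings (k * k)).map n).sum, fun l hl => hn l (mem_allStrings.1 hl) _ ?_⟩
    exact List.single_le_sum (by simp) _ (List.mem_map_of_mem hl)
  refine ⟨fun k => Nat.find (hex k), fun k => ((allStrings (k * k)).map fun l =>
    (g^[Nat.find (hex k)] (evalInit c l)).2.2.1.length).sum,
    Computable.find hP.computablePred hex, ?_, ?_⟩
  · have h₁ : Primrec₂ fun (k T : ℕ) => ((allStrings (k * k)).map fun l =>
        (g^[T] (evalInit c l)).2.2.1.length).sum := by
      have : Primrec (List.sum : List ℕ → ℕ) :=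
        (list_foldr .id (const 0) (nat_add.comp (fst.comp snd) (snd.comp snd)).to₂).of_eq
          fun l => rfl
      exact this.comp (list_map (primrec_allStrings.comp (nat_mul.comp fst fst))
        (list_length.comp (fst.comp (snd.comp (snd.comp
          (nat_iterate (snd.comp fst) (hinit.comp snd) (hg.comp snd).to₂))))).to₂)
    exact h₁.to_comp.comp .id (Computable.find hP.computablePred hex)
  · intro k l hl v hv
    obtain ⟨n, v', hv', hn⟩ := hs k l hl
    obtain rfl := Part.mem_unique hv hv'
    have hle : n ≤ Nat.find (hex k) := hn.le_of_iterate_eq_none (by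
      rw [← hit, hstep]
      exact Nat.find_spec (hex k) l (mem_allStrings.2 hl))
    refine ⟨?_, n, hle, hn⟩
    refine le_trans (le_of_eq ?_) (List.single_le_sum (by simp) _
      (List.mem_map_of_mem (mem_allStrings.2 hl)))
    have := (hit _ _).trans (hn.iterate_eq_of_le ((hstep _).2 rfl) hle)
    exact (congrArg (fun d => (TM2.Cfg.stk d K'.main).length) this).symm

end evaluator

end DSN

/-! ### The Turing machine: parsing, evaluation, and interpretation of instructions. -/

namespace DSN

open Turing PartrecToTM2

/-! ### Instructions -/

/-- The instructions by which the output is assembled. -/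
inductive Op
  | write (x : Option Bool)
  | size
  | term
  | next
  | budget
  | clear

/-- The data on which the instructions operate: the output written so far (which grows at its
front), a list of terminals, the number of vertices, and the digits of the budget. -/
structure Regs where
  out : List (Option Bool)
  terms : List ℕ
  size : ℕ
  budget : List Bool

/-- The effect of an instruction. -/
def Op.exec : Op → Regs → Regs
  | .write x, R => { R with out := x :: R.out }
  | .size, R => { R with out := List.replicate R.size (some true) ++ R.out }
  | .term, R => { R with
      out := List.replicate (R.terms.headD 0) (some true) ++ R.out
      terms := R.terms.headD 0 :: R.terms.tail }
  | .next, R => { R with terms := R.terms.tail }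
  | .budget, R => { R with out := R.budget.map some ++ R.out, budget := [] }
  | .clear, R => { R with out := [] }

/-- The instruction with a given binary code. -/
def Op.ofBits : Bool → Bool → Bool → Op
  | false, false, false => .write none
  | false, false, true => .write (some false)
  | false, true, false => .write (some true)
  | false, true, true => .size
  | true, false, false => .term
  | true, false, true => .next
  | true, true, false => .budget
  | true, true, true => .clear

/-- The binary code of an instruction. -/
def Op.bits : Op → Bool × Bool × Bool
  | .write none => (false, false, false)
  | .write (some false) => (false, false, true)
  | .write (some true) => (false, true, false)
  | .size => (false, true, true)
  | .term => (true, false, false)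
  | .next => (true, false, true)
  | .budget => (true, true, false)
  | .clear => (true, true, true)

/-- The code of an instruction in a program. -/
def Op.code (o : Op) : List Bool := [false, o.bits.1, o.bits.2.1, o.bits.2.2]

theorem Op.ofBits_bits (o : Op) : Op.ofBits o.bits.1 o.bits.2.1 o.bits.2.2 = o := by
  rcases o with (_ | _ | _) | _ | _ | _ | _ | _ <;> rfl

/-! ### The machine that computes the reduction -/

/-- The stacks of the machine. -/
inductive Stk
  | io
  | terms
  | size
  | budget
  | sub (k : K')
  deriving DecidableEq

instance : Fintype K' := ⟨{.main, .rev, .aux, .stack}, fun k => by cases k <;> simp⟩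

instance : Fintype Stk :=
  ⟨{.io, .terms, .size, .budget} ∪ Finset.univ.image Stk.sub, fun k => by cases k <;> simp⟩

/-- The alphabets of the stacks. -/
@[reducible] def Stk.Sym : Stk → Type
  | .io => Option Bool
  | .terms => Γ'
  | .size => Γ'
  | .budget => Γ'
  | .sub _ => Γ'

/-- The labels of the machine outside the evaluation of a code. -/
inductive Phase
  | order | matrix | unmatrix | count | readTerm | readSize | readBudget
  | dispatch | size | unsize | term | unterm | next | budget | clear
  | clearTerms | clearSize | clearBudget
  deriving DecidableEq

instance : Fintype Phase :=
  ⟨{.order, .matrix, .unmatrix, .count, .readTerm, .readSize, .readBudget, .dispatch, .size,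
    .unsize, .term, .unterm, .next, .budget, .clear, .clearTerms, .clearSize, .clearBudget},
    fun p => by cases p <;> simp⟩

/-- A symbol of the input as a symbol of the machine. -/
def toSymbol (x : Option Bool) : Γ' := x.elim .cons bitSymbol

section machine

variable {Λ : Type}

/-- The statements of the machine. -/
abbrev MStmt (Λ : Type) := TM2.Stmt Stk.Sym (Phase ⊕ Λ) (Option Γ')

open TM2.Stmt

/-- Go to a phase. -/
def goPhase (p : Phase) : MStmt Λ := goto fun _ => .inl p

/-- Pop a symbol from the input. -/
def popIo (q : MStmt Λ) : MStmt Λ := pop .io (fun _ x => x.map toSymbol) q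

/-- Pop a symbol from a stack of the evaluator. -/
def popSub (k : K') (q : MStmt Λ) : MStmt Λ := pop (.sub k) (fun _ x => x) q

/-- Push a symbol to a stack of the evaluator. -/
def pushSub (k : K') (x : Γ') (q : MStmt Λ) : MStmt Λ := push (.sub k) (fun _ => x) q

/-- Branch according to whether the last symbol was the digit one. -/
def ifOne (q q' : MStmt Λ) : MStmt Λ := branch (fun v => v = some .bit1) q q'

/-- Branch according to whether there was a symbol. -/
def ifSome (q q' : MStmt Λ) : MStmt Λ := branch Option.isSome q q'

/-- Start an instruction. -/
def opStmt : Op → MStmt Λ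
  | .write x => push .io (fun _ => x) (goPhase .dispatch)
  | .size => goPhase .size
  | .term => goPhase .term
  | .next => goPhase .next
  | .budget => goPhase .budget
  | .clear => goPhase .clear

/-- The statements of the phases, where `l₀` is the initial label of the evaluator. -/
def phaseStmt (l₀ : Λ) : Phase → MStmt Λ
  | .order => popIo <| ifOne (pushSub .aux .bit1 <| goPhase .order) (goPhase .matrix)
  -- The separator is replaced by `bit1` and `cons`, so that the digits put back on top by
  -- `.unmatrix` form the evaluator's input for the number of the matrix.
  | .matrix => popIo <| branch (fun v => v = some .cons)
      (pushSub .main .cons <| pushSub .main .bit1 <| goPhase .unmatrix)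
      (push (.sub .rev) (fun v => v.getD .cons) <| goPhase .matrix)
  | .unmatrix => popSub .rev <| ifSome
      (push (.sub .main) (fun v => v.getD .cons) <| goPhase .unmatrix) (goPhase .count)
  | .count => popSub .aux <| ifSome
      (push .terms (fun _ => Γ'.cons) <| goPhase .readTerm) (goPhase .readSize)
  | .readTerm => popIo <| ifOne
      (push .terms (fun _ => Γ'.bit1) <| goPhase .readTerm) (goPhase .count)
  | .readSize => popIo <| ifOne
      (push .size (fun _ => Γ'.bit1) <| goPhase .readSize) (goPhase .readBudget)
  | .readBudget => popIo <| branch (fun v => v = some .cons)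
      (load (fun _ => none) <| goto fun _ => .inr l₀)
      (push .budget (fun v => v.getD Γ'.cons) <| goPhase .readBudget)
  | .dispatch => popSub .main <| ifOne (popSub .main <| goPhase .clearTerms) <|
      popSub .main <| ifOne
        (popSub .main <| ifOne
          (popSub .main <| ifOne (opStmt (.ofBits true true true))
            (opStmt (.ofBits true true false)))
          (popSub .main <| ifOne (opStmt (.ofBits true false true))
            (opStmt (.ofBits true false false))))
        (popSub .main <| ifOne
          (popSub .main <| ifOne (opStmt (.ofBits false true true))
            (opStmt (.ofBits false true false)))
          (popSub .main <| ifOne (opStmt (.ofBits false false true))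
            (opStmt (.ofBits false false false))))
  | .size => pop .size (fun _ x => x) <| ifSome
      (push .io (fun _ => some true) <| pushSub .rev .bit1 <| goPhase .size) (goPhase .unsize)
  | .unsize => popSub .rev <| ifSome
      (push .size (fun _ => Γ'.bit1) <| goPhase .unsize) (goPhase .dispatch)
  | .term => pop .terms (fun _ x => x) <| ifOne
      (push .io (fun _ => some true) <| pushSub .rev .bit1 <| goPhase .term)
      (push .terms (fun _ => Γ'.cons) <| goPhase .unterm)
  | .unterm => popSub .rev <| ifSome
      (push .terms (fun _ => Γ'.bit1) <| goPhase .unterm) (goPhase .dispatch)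
  | .next => pop .terms (fun _ x => x) <| ifOne (goPhase .next) (goPhase .dispatch)
  | .budget => pop .budget (fun _ x => x) <| ifSome
      (push .io (fun v => some (v = some .bit1)) <| goPhase .budget) (goPhase .dispatch)
  | .clear => popIo <| ifSome (goPhase .clear) (goPhase .dispatch)
  | .clearTerms => pop .terms (fun _ x => x) <| ifSome (goPhase .clearTerms) (goPhase .clearSize)
  | .clearSize => pop .size (fun _ x => x) <| ifSome (goPhase .clearSize) (goPhase .clearBudget)
  | .clearBudget => pop .budget (fun _ x => x) <| ifSome (goPhase .clearBudget)
      (load (fun _ => none) halt)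

/-- A statement of the evaluator as a statement of the machine. -/
def embedStmt : TM2.Stmt (fun _ : K' => Γ') Λ (Option Γ') → MStmt Λ
  | .push k f q => .push (.sub k) f (embedStmt q)
  | .peek k f q => .peek (.sub k) f (embedStmt q)
  | .pop k f q => .pop (.sub k) f (embedStmt q)
  | .load f q => .load f (embedStmt q)
  | .branch f q₁ q₂ => .branch f (embedStmt q₁) (embedStmt q₂)
  | .goto l => .goto fun v => .inr (l v)
  | .halt => goPhase .dispatch

variable (l₀ : Λ) (M : Λ → TM2.Stmt (fun _ : K' => Γ') Λ (Option Γ'))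

/-- The program of the machine. -/
def program : Phase ⊕ Λ → MStmt Λ := Sum.elim (phaseStmt l₀) fun q => embedStmt (M q)

/-- The contents of the stacks. -/
def mkStacks (io : List (Option Bool)) (ts sz bd : List Γ') (T : K' → List Γ') :
    ∀ k : Stk, List k.Sym
  | .io => io
  | .terms => ts
  | .size => sz
  | .budget => bd
  | .sub k => T k

section update

variable (io io' : List (Option Bool)) (ts sz bd l : List Γ') (T : K' → List Γ')

@[simp] theorem update_io : Function.update (mkStacks io ts sz bd T) .io io' =
    mkStacks io' ts sz bd T := by
  funext k; cases k <;> rfl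

@[simp] theorem update_terms : Function.update (mkStacks io ts sz bd T) .terms l =
    mkStacks io l sz bd T := by
  funext k; cases k <;> rfl

@[simp] theorem update_size : Function.update (mkStacks io ts sz bd T) .size l =
    mkStacks io ts l bd T := by
  funext k; cases k <;> rfl

@[simp] theorem update_budget : Function.update (mkStacks io ts sz bd T) .budget l =
    mkStacks io ts sz l T := by
  funext k; cases k <;> rfl

@[simp] theorem update_sub (k : K') : Function.update (mkStacks io ts sz bd T) (.sub k) l =
    mkStacks io ts sz bd (Function.update T k l) := by
  funext k'
  cases k' with
  | sub k' =>
    simp only [mkStacks]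
    by_cases h : k' = k
    · subst h; simp
    · rw [Function.update_of_ne h, Function.update_of_ne (by simpa using h)]; rfl
  | _ => rfl

end update

/-- A configuration in a phase. -/
def phaseCfg (p : Phase) (v : Option Γ') (io : List (Option Bool)) (ts sz bd m r a : List Γ') :
    TM2.Cfg Stk.Sym (Phase ⊕ Λ) (Option Γ') :=
  ⟨some (.inl p), v, mkStacks io ts sz bd (K'.elim m r a [])⟩

/-- A configuration of the evaluator as a configuration of the machine. -/
def embedCfg (io : List (Option Bool)) (ts sz bd : List Γ')
    (c : TM2.Cfg (fun _ : K' => Γ') Λ (Option Γ')) : TM2.Cfg Stk.Sym (Phase ⊕ Λ) (Option Γ') :=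
  ⟨some (c.l.elim (.inl .dispatch) .inr), c.var, mkStacks io ts sz bd c.stk⟩

variable (io : List (Option Bool)) (ts sz bd m r a : List Γ') (v : Option Γ')

theorem stepAux_embedStmt (q : TM2.Stmt (fun _ : K' => Γ') Λ (Option Γ')) (v : Option Γ')
    (T : K' → List Γ') : TM2.stepAux (embedStmt q) v (mkStacks io ts sz bd T) =
      embedCfg io ts sz bd (TM2.stepAux q v T) := by
  induction q generalizing v T with
  | branch f q₁ q₂ ih₁ ih₂ =>
    simp only [embedStmt, TM2.stepAux]
    cases f v
    · exact ih₂ _ _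
    · exact ih₁ _ _
  | goto | halt => rfl
  | load f q ih => exact ih _ _
  | peek k f q ih => exact ih _ _
  | push k f q ih | pop k f q ih =>
    simp only [embedStmt, TM2.stepAux, update_sub]
    exact ih _ _

/-- The evaluator touches only its own stacks while the data of the instance wait on the others.
When it would halt, `.dispatch` takes over and reads the number left on `main` as a program. -/
theorem StepsTo.embed {n : ℕ} {c d : TM2.Cfg (fun _ : K' => Γ') Λ (Option Γ')}
    (h : StepsTo (TM2.step M) n c d) :
    StepsTo (TM2.step (program l₀ M)) n (embedCfg io ts sz bd c) (embedCfg io ts sz bd d) := by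
  induction h with
  | refl => exact .refl _
  | @head _ c _ _ h _ ih =>
    refine .head ?_ ih
    obtain ⟨_ | l, v, T⟩ := c
    · simp [TM2.step] at h
    · rw [← Option.some_inj.1 h]
      exact congrArg some (stepAux_embedStmt io ts sz bd (M l) v T)

attribute [local simp] program phaseStmt TM2.step TM2.stepAux phaseCfg mkStacks popIo ifOne ifSome
  pushSub popSub goPhase toSymbol bitSymbol

theorem steps_order (k : ℕ) : StepsTo (TM2.step (program l₀ M)) (k + 1)
    (phaseCfg .order v (List.replicate k (some true) ++ none :: io) ts sz bd m r a)
    (phaseCfg .matrix (some .cons) io ts sz bd m r (List.replicate k .bit1 ++ a)) := by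
  induction k generalizing v a with
  | zero => exact .single (by simp)
  | succ k ih =>
    rw [show List.replicate (k + 1) Γ'.bit1 ++ a = List.replicate k Γ'.bit1 ++ Γ'.bit1 :: a by
      simp [List.replicate_succ']]
    exact .head (by simp [List.replicate_succ]) (ih (.bit1 :: a) (some .bit1))

theorem steps_matrix (w : List Bool) : StepsTo (TM2.step (program l₀ M)) (w.length + 1)
    (phaseCfg .matrix v (w.map some ++ none :: io) ts sz bd m r a)
    (phaseCfg .unmatrix (some .cons) io ts sz bd (.bit1 :: .cons :: m)
      ((w.map bitSymbol).reverse ++ r) a) := by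
  induction w generalizing v r with
  | nil => exact .single (by simp)
  | cons b w ih =>
    rw [show ((b :: w).map bitSymbol).reverse ++ r = (w.map bitSymbol).reverse ++ bitSymbol b :: r by
      simp]
    exact .head (by cases b <;> simp) (ih (bitSymbol b :: r) (some (bitSymbol b)))

theorem steps_unmatrix : StepsTo (TM2.step (program l₀ M)) (r.length + 1)
    (phaseCfg .unmatrix v io ts sz bd m r a)
    (phaseCfg .count none io ts sz bd (r.reverse ++ m) [] a) := by
  induction r generalizing v m with
  | nil => exact .single (by simp)
  | cons x r ih =>
    rw [show (x :: r).reverse ++ m = r.reverse ++ x :: m by simp]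
    exact .head (by simp) (ih (x :: m) (some x))

theorem steps_readTerm (t : ℕ) : StepsTo (TM2.step (program l₀ M)) (t + 1)
    (phaseCfg .readTerm v (List.replicate t (some true) ++ none :: io) ts sz bd m r a)
    (phaseCfg .count (some .cons) io (List.replicate t .bit1 ++ ts) sz bd m r a) := by
  induction t generalizing v ts with
  | zero => exact .single (by simp)
  | succ t ih =>
    rw [show List.replicate (t + 1) Γ'.bit1 ++ ts = List.replicate t Γ'.bit1 ++ Γ'.bit1 :: ts by
      simp [List.replicate_succ']]
    exact .head (by simp [List.replicate_succ]) (ih (.bit1 :: ts) (some .bit1))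

/-- A list of terminals on its stack. -/
def termSymbols (l : List ℕ) : List Γ' := l.flatMap fun t => List.replicate t .bit1 ++ [.cons]

/-- The stack `aux` holds the number of terminals still to be read and ends up empty, as the
evaluator requires. Reading pushes, so the last terminal ends on top. -/
theorem steps_count (l : List ℕ) :
    StepsTo (TM2.step (program l₀ M)) ((l.map fun t => t + 2).sum + 1)
    (phaseCfg .count v (l.flatMap unary ++ io) ts sz bd m r (List.replicate l.length .bit1))
    (phaseCfg .readSize none io (termSymbols l.reverse ++ ts) sz bd m r []) := by
  induction l generalizing v ts with
  | nil => exact .single (by simp [termSymbols])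
  | cons t l ih =>
    have h₁ : StepsTo (TM2.step (program l₀ M)) 1
        (phaseCfg .count v ((t :: l).flatMap unary ++ io) ts sz bd m r
          (List.replicate (l.length + 1) .bit1))
        (phaseCfg .readTerm (some .bit1) (List.replicate t (some true) ++ none ::
          (l.flatMap unary ++ io)) (.cons :: ts) sz bd m r (List.replicate l.length .bit1)) :=
      .single (by simp [List.replicate_succ, unary])
    have h₂ := steps_readTerm l₀ M (l.flatMap unary ++ io) (.cons :: ts) sz bd m r
      (List.replicate l.length .bit1) (some .bit1) t
    have h₃ := (h₁.trans h₂).trans (ih _ _)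
    convert! h₃ using 1
    · simp; omega
    · simp [termSymbols]

theorem steps_readSize (n : ℕ) : StepsTo (TM2.step (program l₀ M)) (n + 1)
    (phaseCfg .readSize v (List.replicate n (some true) ++ none :: io) ts sz bd m r a)
    (phaseCfg .readBudget (some .cons) io ts (List.replicate n .bit1 ++ sz) bd m r a) := by
  induction n generalizing v sz with
  | zero => exact .single (by simp)
  | succ n ih =>
    rw [show List.replicate (n + 1) Γ'.bit1 ++ sz = List.replicate n Γ'.bit1 ++ Γ'.bit1 :: sz by
      simp [List.replicate_succ']]
    exact .head (by simp [List.replicate_succ]) (ih (.bit1 :: sz) (some .bit1))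

theorem steps_readBudget (b : List Bool) : StepsTo (TM2.step (program l₀ M)) (b.length + 1)
    (phaseCfg .readBudget v (b.map some ++ none :: io) ts sz bd m r a)
    (embedCfg io ts sz ((b.map bitSymbol).reverse ++ bd)
      ⟨some l₀, none, K'.elim m r a []⟩) := by
  induction b generalizing v bd with
  | nil => exact .single (by simp [embedCfg])
  | cons x b ih =>
    rw [show ((x :: b).map bitSymbol).reverse ++ bd = (b.map bitSymbol).reverse ++
      bitSymbol x :: bd by simp]
    exact .head (by cases x <;> simp) (ih (bitSymbol x :: bd) (some (bitSymbol x)))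

/-! #### Instructions -/

/-- The size is written many times but popping destroys it, so a copy is kept on `rev` for `.unsize`
to restore. Terminals are treated likewise. -/
theorem steps_size (n : ℕ) : StepsTo (TM2.step (program l₀ M)) (n + 1)
    (phaseCfg .size v io ts (List.replicate n .bit1) bd m r a)
    (phaseCfg .unsize none (List.replicate n (some true) ++ io) ts [] bd m
      (List.replicate n .bit1 ++ r) a) := by
  induction n generalizing v io r with
  | zero => exact .single (by simp)
  | succ n ih =>
    rw [show List.replicate (n + 1) Γ'.bit1 ++ r = List.replicate n Γ'.bit1 ++ Γ'.bit1 :: r by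
      simp [List.replicate_succ'], show List.replicate (n + 1) (some true) ++ io =
      List.replicate n (some true) ++ some true :: io by simp [List.replicate_succ']]
    exact .head (by simp [List.replicate_succ]) (ih (some true :: io) (.bit1 :: r) (some .bit1))

theorem steps_unsize (n : ℕ) : StepsTo (TM2.step (program l₀ M)) (n + 1)
    (phaseCfg .unsize v io ts sz bd m (List.replicate n .bit1) a)
    (phaseCfg .dispatch none io ts (List.replicate n .bit1 ++ sz) bd m [] a) := by
  induction n generalizing v sz with
  | zero => exact .single (by simp)
  | succ n ih =>
    rw [show List.replicate (n + 1) Γ'.bit1 ++ sz = List.replicate n Γ'.bit1 ++ Γ'.bit1 :: sz by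
      simp [List.replicate_succ']]
    exact .head (by simp [List.replicate_succ]) (ih (.bit1 :: sz) (some .bit1))

theorem steps_term (l : List ℕ) : ∃ v', StepsTo (TM2.step (program l₀ M)) (l.headD 0 + 1)
    (phaseCfg .term v io (termSymbols l) sz bd m r a)
    (phaseCfg .unterm v' (List.replicate (l.headD 0) (some true) ++ io)
      (.cons :: termSymbols l.tail) sz bd m (List.replicate (l.headD 0) .bit1 ++ r) a) := by
  -- An empty stack behaves like a terminal `0`, in agreement with `headD 0` in `Op.exec`.
  rcases l with _ | ⟨t, l⟩
  · exact ⟨none, .single (by simp [termSymbols])⟩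
  · refine ⟨some .cons, ?_⟩
    rw [show termSymbols (t :: l) = List.replicate t .bit1 ++ .cons :: termSymbols l by
      simp [termSymbols]]
    simp only [List.headD_cons, List.tail_cons]
    induction t generalizing v io r with
    | zero => exact .single (by simp)
    | succ n ih =>
      rw [show List.replicate (n + 1) Γ'.bit1 ++ r = List.replicate n Γ'.bit1 ++ Γ'.bit1 :: r by
        simp [List.replicate_succ'], show List.replicate (n + 1) (some true) ++ io =
        List.replicate n (some true) ++ some true :: io by simp [List.replicate_succ']]
      exact .head (by simp [List.replicate_succ]) (ih (some true :: io) (.bit1 :: r) (some .bit1))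

theorem steps_unterm (n : ℕ) : StepsTo (TM2.step (program l₀ M)) (n + 1)
    (phaseCfg .unterm v io ts sz bd m (List.replicate n .bit1) a)
    (phaseCfg .dispatch none io (List.replicate n .bit1 ++ ts) sz bd m [] a) := by
  induction n generalizing v ts with
  | zero => exact .single (by simp)
  | succ n ih =>
    rw [show List.replicate (n + 1) Γ'.bit1 ++ ts = List.replicate n Γ'.bit1 ++ Γ'.bit1 :: ts by
      simp [List.replicate_succ']]
    exact .head (by simp [List.replicate_succ]) (ih (.bit1 :: ts) (some .bit1))

theorem steps_next (l : List ℕ) : ∃ v', StepsTo (TM2.step (program l₀ M)) (l.headD 0 + 1)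
    (phaseCfg .next v io (termSymbols l) sz bd m r a)
    (phaseCfg .dispatch v' io (termSymbols l.tail) sz bd m r a) := by
  rcases l with _ | ⟨t, l⟩
  · exact ⟨none, .single (by simp [termSymbols])⟩
  · refine ⟨some .cons, ?_⟩
    rw [show termSymbols (t :: l) = List.replicate t .bit1 ++ .cons :: termSymbols l by
      simp [termSymbols]]
    simp only [List.headD_cons, List.tail_cons]
    induction t generalizing v with
    | zero => exact .single (by simp)
    | succ n ih => exact .head (by simp [List.replicate_succ]) (ih (some .bit1))

theorem steps_budget (b : List Bool) : StepsTo (TM2.step (program l₀ M)) (b.length + 1)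
    (phaseCfg .budget v io ts sz (b.map bitSymbol) m r a)
    (phaseCfg .dispatch none ((b.map some).reverse ++ io) ts sz [] m r a) := by
  induction b generalizing v io with
  | nil => exact .single (by simp)
  | cons x b ih =>
    rw [show ((x :: b).map some).reverse ++ io = (b.map some).reverse ++ some x :: io by simp]
    exact .head (by cases x <;> simp) (ih (some x :: io) (some (bitSymbol x)))

theorem steps_clear : StepsTo (TM2.step (program l₀ M)) (io.length + 1)
    (phaseCfg .clear v io ts sz bd m r a) (phaseCfg .dispatch none [] ts sz bd m r a) := by
  induction io generalizing v with
  | nil => exact .single (by simp)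
  | cons x io ih => exact .head (by simp) (ih (some (toSymbol x)))

theorem steps_clearTerms : StepsTo (TM2.step (program l₀ M)) (ts.length + 1)
    (phaseCfg .clearTerms v io ts sz bd m r a)
    (phaseCfg .clearSize none io [] sz bd m r a) := by
  induction ts generalizing v with
  | nil => exact .single (by simp)
  | cons x ts ih => exact .head (by simp) (ih (some x))

theorem steps_clearSize : StepsTo (TM2.step (program l₀ M)) (sz.length + 1)
    (phaseCfg .clearSize v io ts sz bd m r a)
    (phaseCfg .clearBudget none io ts [] bd m r a) := by
  induction sz generalizing v with
  | nil => exact .single (by simp)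
  | cons x sz ih => exact .head (by simp) (ih (some x))

theorem steps_clearBudget : StepsTo (TM2.step (program l₀ M)) (bd.length + 1)
    (phaseCfg .clearBudget v io ts sz bd m r a)
    ⟨none, none, mkStacks io ts sz [] (K'.elim m r a [])⟩ := by
  induction bd generalizing v with
  | nil => exact .single (by simp)
  | cons x bd ih => exact .head (by simp) (ih (some x))

/-- The total size of the registers. -/
def Regs.mass (R : Regs) : ℕ :=
  R.out.length + (R.terms.map fun t => t + 1).sum + R.size + R.budget.length

/-- The configuration in which the registers have given values. -/
def regCfg (p : Phase) (v : Option Γ') (R : Regs) (m : List Γ') :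
    TM2.Cfg Stk.Sym (Phase ⊕ Λ) (Option Γ') :=
  phaseCfg p v R.out (termSymbols R.terms) (List.replicate R.size .bit1)
    (R.budget.map bitSymbol).reverse m [] []

/-- The initial `false` of every `Op.code` tells an instruction from the `bit1` that ends the
program. -/
theorem step_dispatch (R : Regs) (o : Op) :
    TM2.step (program l₀ M) (regCfg .dispatch v R (o.code.map bitSymbol ++ m)) =
      some (TM2.stepAux (opStmt o) (some (bitSymbol o.bits.2.2)) (regCfg (Λ := Λ) .dispatch v R m).stk) := by
  have ho := o.ofBits_bits
  simp only [Op.code]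
  generalize o.bits.1 = x, o.bits.2.1 = y, o.bits.2.2 = z at *
  subst ho
  cases x <;> cases y <;> cases z <;> simp [regCfg]

/-- The worst case copies a register and restores it: two loops of `n + 1` steps each after one step
of dispatching. -/
theorem steps_op (R : Regs) (o : Op) : ∃ v' n, n ≤ 2 * R.mass + 3 ∧
    StepsTo (TM2.step (program l₀ M)) n (regCfg .dispatch v R (o.code.map bitSymbol ++ m))
      (regCfg .dispatch v' (o.exec R) m) := by
  have hd := step_dispatch l₀ M m v R o
  have hhead : R.terms.headD 0 ≤ (R.terms.map fun t => t + 1).sum := by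
    rcases R.terms with _ | ⟨t, l⟩
    · simp
    · simp; omega
  unfold Regs.mass
  cases o with
  | write x => exact ⟨_, 1, by omega, .single (hd.trans (by simp [opStmt, regCfg, Op.exec]; rfl))⟩
  | size =>
    have h₁ := steps_size l₀ M R.out (termSymbols R.terms) (R.budget.map bitSymbol).reverse
      m [] [] (some (bitSymbol Op.size.bits.2.2)) R.size
    have h₂ := steps_unsize l₀ M (List.replicate R.size (some true) ++ R.out)
      (termSymbols R.terms) [] (R.budget.map bitSymbol).reverse m [] none R.size
    rw [List.append_nil] at h₁ h₂
    exact ⟨_, _, by omega, .head hd (h₁.trans h₂)⟩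
  | term =>
    obtain ⟨v', h₁⟩ := steps_term l₀ M R.out (List.replicate R.size .bit1)
      (R.budget.map bitSymbol).reverse m [] [] (some (bitSymbol Op.term.bits.2.2)) R.terms
    have h₂ := steps_unterm l₀ M (List.replicate (R.terms.headD 0) (some true) ++ R.out)
      (.cons :: termSymbols R.terms.tail) (List.replicate R.size .bit1)
      (R.budget.map bitSymbol).reverse m [] v' (R.terms.headD 0)
    rw [List.append_nil] at h₁
    refine ⟨none, R.terms.headD 0 + 1 + (R.terms.headD 0 + 1) + 1, by omega,
      .head hd (h₁.trans ?_)⟩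
    convert! h₂ using 1
    simp [regCfg, Op.exec, termSymbols]
  | next =>
    obtain ⟨v', h⟩ := steps_next l₀ M R.out (List.replicate R.size .bit1)
      (R.budget.map bitSymbol).reverse m [] [] (some (bitSymbol Op.next.bits.2.2)) R.terms
    exact ⟨v', _, by omega, .head hd h⟩
  | budget =>
    have h := steps_budget l₀ M R.out (termSymbols R.terms) (List.replicate R.size .bit1)
      m [] [] (some (bitSymbol Op.budget.bits.2.2)) R.budget.reverse
    refine ⟨none, R.budget.reverse.length + 1 + 1, by simp; omega, .head hd ?_⟩
    convert! h using 1
    · simp [regCfg, opStmt]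
    · simp [regCfg, Op.exec]
  | clear =>
    exact ⟨none, _, by omega, .head hd (steps_clear l₀ M R.out _ _ _ m [] [] _)⟩

/-- An instruction adds at most the content of one register to the output, plus one symbol; thus
`mass + 1` at most doubles. -/
theorem mass_exec (R : Regs) (o : Op) : (o.exec R).mass ≤ 2 * R.mass + 1 := by
  obtain ⟨out, terms, size, budget⟩ := R
  unfold Regs.mass
  cases o <;> cases terms <;> simp [Op.exec] <;> omega

/-- The result of executing a list of instructions, the first instruction first. -/
def execList (l : List Op) (R : Regs) : Regs := l.foldl (fun R o => o.exec R) R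

/-- A geometric sum: an instruction costs at most `3 * (mass + 1)` steps, and `mass + 1` at most
doubles each time. The summand `3 * (R.mass + 1)` on the left avoids a subtraction. -/
theorem steps_execList (l : List Op) (R : Regs) : ∃ v' n,
    n + 3 * (R.mass + 1) ≤ 3 * 2 ^ l.length * (R.mass + 1) ∧
    (execList l R).mass + 1 ≤ 2 ^ l.length * (R.mass + 1) ∧
    StepsTo (TM2.step (program l₀ M)) n
      (regCfg .dispatch v R ((l.flatMap Op.code).map bitSymbol ++ m))
      (regCfg .dispatch v' (execList l R) m) := by
  induction l generalizing v R with
  | nil => exact ⟨v, 0, by simp, by simp [execList], .refl _⟩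
  | cons o l ih =>
    obtain ⟨v₁, n₁, hn₁, h₁⟩ := steps_op l₀ M ((l.flatMap Op.code).map bitSymbol ++ m) v R o
    obtain ⟨v₂, n₂, hn₂, hm, h₂⟩ := ih v₁ (o.exec R)
    have hmass := mass_exec R o
    have hle : 2 ^ l.length * ((o.exec R).mass + 1) ≤ 2 ^ (l.length + 1) * (R.mass + 1) := by
      calc 2 ^ l.length * ((o.exec R).mass + 1) ≤ 2 ^ l.length * (2 * (R.mass + 1)) :=
            Nat.mul_le_mul_left _ (by omega)
        _ = _ := by ring
    refine ⟨v₂, n₁ + n₂, ?_, hm.trans hle, ?_⟩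
    · obtain ⟨Q, hQ⟩ := Nat.exists_eq_add_of_le' (Nat.one_le_two_pow (n := l.length))
      rw [hQ] at hn₂
      rw [List.length_cons, pow_succ, hQ]
      have : Q * ((o.exec R).mass + 1) ≤ Q * (2 * (R.mass + 1)) :=
        Nat.mul_le_mul_left _ (by omega)
      linarith
    · rw [List.flatMap_cons, List.map_append, List.append_assoc]
      exact h₁.trans h₂

theorem length_termSymbols (l : List ℕ) :
    (termSymbols l).length = (l.map fun t => t + 1).sum := by
  simp [termSymbols, List.length_flatMap]

/-- `haltList` demands that all stacks except the output be empty and the internal state be initial.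
-/
theorem steps_finish (R : Regs) : ∃ n ≤ R.mass + 4, StepsTo (TM2.step (program l₀ M)) n
    (regCfg .dispatch v R [.bit1, .cons])
    ⟨none, none, mkStacks R.out [] [] [] (K'.elim [] [] [] [])⟩ := by
  have h₁ : StepsTo (TM2.step (program l₀ M)) 1 (regCfg .dispatch v R [.bit1, .cons])
      (regCfg .clearTerms (some .cons) R []) := .single (by simp [regCfg])
  have h₂ := steps_clearTerms l₀ M R.out (termSymbols R.terms) (List.replicate R.size .bit1)
    (R.budget.map bitSymbol).reverse [] [] [] (some .cons)
  have h₃ := steps_clearSize l₀ M R.out [] (List.replicate R.size .bit1)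
    (R.budget.map bitSymbol).reverse [] [] [] none
  have h₄ := steps_clearBudget l₀ M R.out [] [] (R.budget.map bitSymbol).reverse [] [] [] none
  refine ⟨_, ?_, ((h₁.trans h₂).trans h₃).trans h₄⟩
  simp only [length_termSymbols, List.length_replicate, List.length_reverse, List.length_map,
    Regs.mass]
  omega

theorem length_unary (n : ℕ) : (unary n).length = n + 1 := by simp [unary]

/-- The tail `io` is the encoding of the arcs. It is left untouched, and the new instance is written
in front of it; this works because old vertices keep their numbers. -/
theorem steps_parse (w : List Bool) (l : List ℕ) (n : ℕ) (b : List Bool) :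
    ∃ s ≤ 2 * (unary l.length ++ (w.map some ++ [none]) ++ l.flatMap unary ++ unary n ++
      (b.map some ++ [none])).length, StepsTo (TM2.step (program l₀ M)) s
    (phaseCfg .order v (unary l.length ++ (w.map some ++ [none]) ++ l.flatMap unary ++ unary n ++
      (b.map some ++ [none]) ++ io) [] [] [] [] [] [])
    (embedCfg io (termSymbols l.reverse) (List.replicate n .bit1) (b.map bitSymbol).reverse
      ⟨some l₀, none, K'.elim (w.map bitSymbol ++ [.bit1, .cons]) [] [] []⟩) := by
  have h₁ := steps_order l₀ M ((w.map some ++ [none]) ++ l.flatMap unary ++ unary n ++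
      (b.map some ++ [none]) ++ io) [] [] [] [] [] [] v l.length
  have h₂ := steps_matrix l₀ M (l.flatMap unary ++ unary n ++ (b.map some ++ [none]) ++ io)
    [] [] [] [] [] (List.replicate l.length .bit1) (some .cons) w
  have h₃ := steps_unmatrix l₀ M (l.flatMap unary ++ unary n ++ (b.map some ++ [none]) ++ io)
    [] [] [] [.bit1, .cons] (w.map bitSymbol).reverse (List.replicate l.length .bit1) (some .cons)
  have h₄ := steps_count l₀ M (unary n ++ (b.map some ++ [none]) ++ io)
    [] [] [] (w.map bitSymbol ++ [.bit1, .cons]) [] none l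
  have h₅ := steps_readSize l₀ M (b.map some ++ none :: io)
    (termSymbols l.reverse) [] [] (w.map bitSymbol ++ [.bit1, .cons]) [] [] none n
  have h₆ := steps_readBudget l₀ M io (termSymbols l.reverse) (List.replicate n .bit1) []
    (w.map bitSymbol ++ [.bit1, .cons]) [] [] (some .cons) b
  simp only [unary, List.append_assoc, List.cons_append, List.nil_append, List.append_nil,
    List.reverse_reverse] at h₁ h₂ h₃ h₄ h₅ h₆ ⊢
  refine ⟨_, ?_, ((((h₁.trans h₂).trans h₃).trans h₄).trans h₅).trans h₆⟩
  have h : (l.map fun t => t + 2).sum ≤ 2 * (l.map fun t => t + 1).sum := by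
    rw [← List.sum_map_mul_left]
    exact List.sum_le_sum fun t _ => by omega
  simp [List.length_flatMap, length_unary, -List.sum_map_add]
  omega

/-- Parsing costs `2 * L` and evaluation `s`. Of the factor `7`, three parts pay for executing the
program, one for clearing the registers, and three absorb an additive constant. -/
theorem steps_machine (w : List Bool) (l : List ℕ) (n : ℕ) (b : List Bool) (ops : List Op) (s L : ℕ)
    (hL : L = (unary l.length ++ (w.map some ++ [none]) ++ l.flatMap unary ++ unary n ++
      (b.map some ++ [none]) ++ io).length)
    (hs : StepsTo (TM2.step M) s
      ⟨some l₀, none, K'.elim (w.map bitSymbol ++ [.bit1, .cons]) [] [] []⟩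
      ⟨none, none, K'.elim ((ops.flatMap Op.code).map bitSymbol ++ [.bit1, .cons]) [] [] []⟩) :
    ∃ t ≤ 2 * L + s + 7 * 2 ^ ops.length * (L + 1), StepsTo (TM2.step (program l₀ M)) t
    (phaseCfg .order v (unary l.length ++ (w.map some ++ [none]) ++ l.flatMap unary ++ unary n ++
      (b.map some ++ [none]) ++ io) [] [] [] [] [] [])
    ⟨none, none, mkStacks (execList ops ⟨io, l.reverse, n, b⟩).out [] [] []
      (K'.elim [] [] [] [])⟩ := by
  obtain ⟨n₁, hn₁, h₁⟩ := steps_parse l₀ M io v w l n b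
  have h₂ := hs.embed l₀ M io (termSymbols l.reverse) (List.replicate n .bit1)
    (b.map bitSymbol).reverse
  obtain ⟨v₃, n₃, hn₃, hm, h₃⟩ := steps_execList l₀ M [.bit1, .cons] none ops ⟨io, l.reverse, n, b⟩
  obtain ⟨n₄, hn₄, h₄⟩ := steps_finish l₀ M v₃ (execList ops ⟨io, l.reverse, n, b⟩)
  refine ⟨_, ?_, ((h₁.trans h₂).trans h₃).trans h₄⟩
  have hmass : Regs.mass ⟨io, l.reverse, n, b⟩ ≤ L := by
    rw [hL]
    simp [Regs.mass, unary, List.length_flatMap, -List.sum_map_add]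
    omega
  rw [List.length_append] at hL
  have h₅ : 2 ^ ops.length * (Regs.mass ⟨io, l.reverse, n, b⟩ + 1) ≤ 2 ^ ops.length * (L + 1) :=
    Nat.mul_le_mul_left _ (by omega)
  have h₆ : L + 1 ≤ 2 ^ ops.length * (L + 1) := Nat.le_mul_of_pos_left _ (by positivity)
  have h₇ : 3 * 2 ^ ops.length * (Regs.mass ⟨io, l.reverse, n, b⟩ + 1) =
    3 * (2 ^ ops.length * (Regs.mass ⟨io, l.reverse, n, b⟩ + 1)) := by ring
  have h₈ : 7 * 2 ^ ops.length * (L + 1) = 7 * (2 ^ ops.length * (L + 1)) := by ring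
  omega

/-- The machine. -/
def machine [Fintype Λ] : TM2ComputableAux (Option Bool) (Option Bool) where
  tm :=
    { K := Stk
      k₀ := .io
      k₁ := .io
      Γ := Stk.Sym
      Λ := Phase ⊕ Λ
      main := .inl .order
      σ := Option Γ'
      initialState := none
      Γk₀Fin := inferInstanceAs (Fintype (Option Bool))
      m := program l₀ M }
  inputAlphabet := Equiv.refl _
  outputAlphabet := Equiv.refl _

theorem machine_outputs [Fintype Λ] {x y : List (Option Bool)} {t B : ℕ} (ht : t ≤ B)
    (h : StepsTo (TM2.step (program l₀ M)) t (phaseCfg .order none x [] [] [] [] [] [])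
      ⟨none, none, mkStacks y [] [] [] (K'.elim [] [] [] [])⟩) :
    Nonempty (TM2OutputsInTime (machine l₀ M).tm (x.map (machine l₀ M).inputAlphabet.symm)
      (some (y.map (machine l₀ M).outputAlphabet.symm)) B) := by
  refine ⟨⟨⟨t, ?_⟩, ht⟩⟩
  have hx : initList (machine l₀ M).tm (x.map (machine l₀ M).inputAlphabet.symm) =
      phaseCfg .order none x [] [] [] [] [] [] := by
    have : x.map (machine l₀ M).inputAlphabet.symm = x := List.map_id x
    rw [this]
    unfold initList phaseCfg
    congr 1
    funext k
    rcases k with _ | _ | _ | _ | (_ | _ | _ | _) <;> rfl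
  have hy : haltList (machine l₀ M).tm (y.map (machine l₀ M).outputAlphabet.symm) =
      ⟨none, none, mkStacks y [] [] [] (K'.elim [] [] [] [])⟩ := by
    have : y.map (machine l₀ M).outputAlphabet.symm = y := List.map_id y
    rw [this]
    unfold haltList
    congr 1
    funext k
    rcases k with _ | _ | _ | _ | (_ | _ | _ | _) <;> rfl
  rw [Option.map_some, hx, hy]
  exact h.iterate_eq

end machine

end DSN

/-! ### Instructions that write the new instance, and their correctness. -/

namespace DSN

/-! ### The program that writes the new instance -/

/-- The adjacency matrix of the pattern with a given code. -/
def matrixBits (c : ℕ × List (ℕ × ℕ)) : List Bool :=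
  (List.range (c.1 * c.1)).map fun x => decide ((x / c.1, x % c.1) ∈ c.2)

/-- Instructions that write a string. -/
def writeOps (s : List (Option Bool)) : List Op := s.map .write

/-- Instructions that write the name of a new terminal. -/
def vertexOps (u : ℕ) : List Op := .size :: writeOps (unary (u + 1))

/-- Instructions that write the arcs between a new terminal and a hub. -/
def linkOps (h : Op) (u : ℕ) : List Op :=
  vertexOps u ++ ([h] ++ writeOps [none, none] ++ ([h] ++ writeOps [none]) ++ vertexOps u ++
    writeOps [none])

/-- Instructions that write the arcs at the hub of `i`. -/
def hubOps (ψ : List ℕ) (k n₀ : ℕ) (h : Op) (i : ℕ) : List Op :=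
  ((List.range n₀).filter fun u => target ψ k u = i).flatMap (linkOps h)

/-- Instructions that write the new instance. The last instruction is executed first. -/
def buildOps (ψ : List ℕ) (k : ℕ) (c₀ : ℕ × List (ℕ × ℕ)) : List Op :=
  writeOps (unary c₀.1 ++ (matrixBits c₀).map some ++ [none]) ++
    (List.range c₀.1).flatMap vertexOps ++ vertexOps c₀.1 ++ (.budget :: writeOps [none]) ++
    ((List.range k).flatMap fun i => .next :: hubOps ψ k c₀.1 .term i) ++ hubOps ψ k c₀.1 .size k

/-- The result of executing a list of instructions, the last instruction first. -/
def runOps (l : List Op) (R : Regs) : Regs := l.foldr Op.exec R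

theorem execList_reverse (l : List Op) (R : Regs) : execList l.reverse R = runOps l R :=
  List.foldl_reverse

theorem runOps_append (l l' : List Op) (R : Regs) :
    runOps (l ++ l') R = runOps l (runOps l' R) := List.foldr_append

/-- The instructions `l` write the string `s` and do nothing else. -/
def Emits (ts : List ℕ) (n : ℕ) (b : List Bool) (l : List Op) (s : List (Option Bool)) : Prop :=
  ∀ out, runOps l ⟨out, ts, n, b⟩ = ⟨s ++ out, ts, n, b⟩

namespace Emits

variable {ts : List ℕ} {n : ℕ} {b : List Bool}

/-- Since output grows at its front and the last instruction runs first, programs are concatenated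
in the order of the strings they write. -/
theorem append {l l' : List Op} {s s' : List (Option Bool)} (h : Emits ts n b l s)
    (h' : Emits ts n b l' s') : Emits ts n b (l ++ l') (s ++ s') := fun out => by
  rw [runOps_append, h', h, List.append_assoc]

theorem flatMap {α : Type} {L : List α} {f : α → List Op} {g : α → List (Option Bool)}
    (h : ∀ a, Emits ts n b (f a) (g a)) : Emits ts n b (L.flatMap f) (L.flatMap g) := by
  induction L with
  | nil => exact fun out => rfl
  | cons a L ih => exact (h a).append ih

theorem writeOps (s : List (Option Bool)) : Emits ts n b (writeOps s) s := by
  induction s with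
  | nil => exact fun out => rfl
  | cons x s ih => intro out; exact congrArg (Op.write x).exec (ih out)

theorem size : Emits ts n b [.size] (List.replicate n (some true)) := fun _ => rfl

theorem term (t : ℕ) : Emits (t :: ts) n b [.term] (List.replicate t (some true)) := fun _ => rfl

theorem vertexOps (u : ℕ) : Emits ts n b (vertexOps u) (unary (n + 1 + u)) := by
  have h : unary (n + 1 + u) = List.replicate n (some true) ++ unary (u + 1) := by
    rw [unary, unary, ← List.append_assoc, List.replicate_append_replicate]
    congr 2; omega
  rw [h]
  exact size.append (.writeOps _)

/-- The instruction `h` writes no separator; the remaining lone `none` after each arc is `binary 0`,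
the weight zero. -/
theorem linkOps {h : Op} {i : ℕ} (hh : Emits ts n b [h] (List.replicate i (some true))) (u : ℕ) :
    Emits ts n b (linkOps h u) (unary (n + 1 + u) ++ unary i ++ [none] ++
      (unary i ++ unary (n + 1 + u) ++ [none])) := by
  have := (vertexOps (ts := ts) (n := n) (b := b) u).append
    (((hh.append (writeOps [none, none])).append (hh.append (writeOps [none]))).append
    (vertexOps u) |>.append (writeOps [none]))
  convert! this using 1
  simp [unary]

end Emits

/-- The encoding of the arcs at the hub of `i`, which is the vertex `h`. -/
def hubString (ψ : List ℕ) (k n₀ n h i : ℕ) : List (Option Bool) :=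
  ((List.range n₀).filter fun u => target ψ k u = i).flatMap fun u =>
    unary (n + 1 + u) ++ unary h ++ [none] ++ (unary h ++ unary (n + 1 + u) ++ [none])

/-- The groups run from the last to the first, so the hub of the current group is always on top of
the reversed list; `.next` then drops it. -/
theorem runOps_hubs (ψ : List ℕ) (k n₀ n : ℕ) (b : List Bool) (hub : ℕ → ℕ) (j : ℕ)
    (out : List (Option Bool)) :
    runOps ((List.range j).flatMap fun i => .next :: hubOps ψ k n₀ .term i)
      ⟨out, ((List.range j).map hub).reverse, n, b⟩ =
    ⟨((List.range j).flatMap fun i => hubString ψ k n₀ n (hub i) i) ++ out, [], n, b⟩ := by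
  induction j generalizing out with
  | zero => rfl
  | succ j ih =>
    rw [List.range_succ, List.flatMap_append, runOps_append, List.map_append, List.reverse_append,
      List.flatMap_append, List.append_assoc, ← ih]
    congr 1
    have : Emits (hub j :: ((List.range j).map hub).reverse) n b (hubOps ψ k n₀ .term j)
        (hubString ψ k n₀ n (hub j) j) := .flatMap (.linkOps (.term _))
    simp only [List.map_cons, List.map_nil, List.reverse_singleton, List.singleton_append,
      List.flatMap_cons, List.flatMap_nil, List.append_nil]
    change Op.next.exec (runOps _ _) = _
    rw [this]
    rfl

theorem flatMap_finRange {α : Type} (n : ℕ) (f : ℕ → List α) :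
    (List.finRange n).flatMap (fun i : Fin n => f i) = (List.range n).flatMap f := by
  rw [← List.map_coe_finRange_eq_range, List.flatMap_map]

theorem map_finRange {α : Type} (n : ℕ) (f : ℕ → α) :
    (List.finRange n).map (fun i : Fin n => f i) = (List.range n).map f := by
  rw [← List.map_coe_finRange_eq_range, List.map_map]; rfl

theorem flatMap_map_range {α : Type} (m k : ℕ) (f : ℕ → ℕ → α) :
    ((List.range m).flatMap fun i => (List.range k).map (f i)) =
      (List.range (m * k)).map fun x => f (x / k) (x % k) := by
  induction m with
  | zero => simp
  | succ m ih =>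
    rw [List.range_succ, List.flatMap_append, ih, Nat.succ_mul, List.range_add, List.map_append,
      List.flatMap_singleton, List.map_map]
    congr 1
    refine List.map_congr_left fun j hj => ?_
    have hj := List.mem_range.1 hj
    simp only [Function.comp]
    rw [Nat.mul_comm, Nat.mul_add_div (by omega), Nat.mul_add_mod, Nat.div_eq_of_lt hj,
      Nat.mod_eq_of_lt hj, Nat.add_zero]

theorem encodePattern_ofCode (c : ℕ × List (ℕ × ℕ)) :
    encodePattern (Pattern.ofCode c) = unary c.1 ++ (matrixBits c).map some ++ [none] := by
  classical
  have : ((List.finRange c.1).flatMap fun i : Fin c.1 => (List.finRange c.1).map fun j : Fin c.1 =>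
      some (decide (((i : ℕ), (j : ℕ)) ∈ c.2))) = (matrixBits c).map some := by
    rw [matrixBits, List.map_map,
      flatMap_finRange c.1 fun i => (List.finRange c.1).map fun j : Fin c.1 =>
        some (decide ((i, (j : ℕ)) ∈ c.2))]
    have h (i : ℕ) := map_finRange c.1 fun j => some (decide ((i, j) ∈ c.2))
    simp only [h]
    exact flatMap_map_range _ _ fun i j => some (decide ((i, j) ∈ c.2))
  rw [← this, encodePattern]
  congr 3
  funext i
  congr 1; funext j
  congr 1
  exact decide_eq_decide.2 Iff.rfl

theorem matrixBits_injective {k : ℕ} {E E' : List (ℕ × ℕ)}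
    (h : matrixBits (k, E) = matrixBits (k, E')) :
    Pattern.ofCode (k, E) = Pattern.ofCode (k, E') := by
  have key : ∀ i < k, ∀ j < k, (i, j) ∈ E ↔ (i, j) ∈ E' := by
    intro i hi j hj
    have := List.map_inj_left.1 h (i * k + j) (List.mem_range.2 (by nlinarith))
    rwa [Nat.mul_comm, Nat.mul_add_div (by omega), Nat.mul_add_mod, Nat.div_eq_of_lt hj,
      Nat.mod_eq_of_lt hj, Nat.add_zero, decide_eq_decide] at this
  simp only [Pattern.ofCode, Pattern.mk.injEq, heq_eq_eq, true_and, Digraph.mk.injEq]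
  funext i j
  exact propext (key i i.2 j j.2)

theorem length_matrixBits (c : ℕ × List (ℕ × ℕ)) : (matrixBits c).length = c.1 * c.1 := by
  simp [matrixBits]

/-- Every string of square length is an adjacency matrix, so the search terminates on all strings
over which `exists_computable_bounds` takes its maxima. -/
theorem exists_matrixBits {k : ℕ} {l : List Bool} (hl : l.length = k * k) :
    ∃ E, matrixBits (k, E) = l := by
  refine ⟨((List.range (k * k)).filter fun x => l.getD x false).map fun x => (x / k, x % k), ?_⟩
  refine List.ext_getElem (by simp [matrixBits, hl]) fun x hx hx' => ?_
  have hx : x < k * k := hl ▸ hx'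
  have key : (x / k, x % k) ∈ ((List.range (k * k)).filter fun x => l.getD x false).map
      (fun x => (x / k, x % k)) ↔ l[x] = true := by
    simp only [List.mem_map, List.mem_filter, List.mem_range, Prod.mk.injEq]
    constructor
    · rintro ⟨y, ⟨hy, h⟩, h₁, h₂⟩
      obtain rfl : y = x := by rw [← Nat.div_add_mod y k, h₁, h₂, Nat.div_add_mod]
      simpa [hx'] using h
    · intro h
      exact ⟨x, ⟨hx, by simpa [hx'] using h⟩, rfl, rfl⟩
  simp only [matrixBits, List.getElem_map, List.getElem_range, key, Bool.decide_eq_true]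

/-- The encoding of the arcs of an instance. -/
def Input.arcString (I : Input) : List (Option Bool) :=
  I.arcs.flatMap (fun a => unary a.1.1 ++ unary a.1.2 ++ binary a.2)

theorem encodeInput_eq (I : Input) {c : ℕ × List (ℕ × ℕ)} (hI : I.pattern = Pattern.ofCode c) :
    encodeInput I = unary ((List.range I.pattern.order).map I.hub).length ++
      ((matrixBits c).map some ++ [none]) ++ ((List.range I.pattern.order).map I.hub).flatMap unary ++
      unary I.size ++ (I.budget.bits.map some ++ [none]) ++ I.arcString := by
  have h₁ : (List.finRange I.pattern.order).flatMap (fun i => unary (I.terminal i)) =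
      ((List.range I.pattern.order).map I.hub).flatMap unary := by
    rw [List.flatMap_map, ← flatMap_finRange]
    congr 1; funext i
    rw [I.hub_of_lt i.2]
  have h₂ : I.pattern.order = c.1 := by rw [hI]; rfl
  rw [encodeInput, h₁, hI, encodePattern_ofCode, List.length_map, List.length_range, ← hI, h₂]
  simp [binary, Input.arcString]

theorem runOps_buildOps (I : Input) (ψ : List ℕ) (c₀ : ℕ × List (ℕ × ℕ)) :
    (runOps (buildOps ψ I.pattern.order c₀) ⟨I.arcString,
      ((List.range I.pattern.order).map I.hub).reverse, I.size, I.budget.bits⟩).out =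
    encodeInput (I.build (Pattern.ofCode c₀) (target ψ I.pattern.order)) := by
  set k := I.pattern.order with hk
  have h₁ : ∀ ts, Emits ts I.size I.budget.bits (hubOps ψ k c₀.1 .size k)
    (hubString ψ k c₀.1 I.size I.size k) := fun ts => .flatMap (.linkOps .size)
  -- The budget register `b` is arbitrary because these instructions run after `.budget` has emptied
  -- it.
  have h₂ : ∀ ts b, Emits ts I.size b (writeOps (unary c₀.1 ++ (matrixBits c₀).map some ++ [none]) ++
    (List.range c₀.1).flatMap vertexOps ++ vertexOps c₀.1) (encodePattern (Pattern.ofCode c₀) ++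
      (List.range c₀.1).flatMap (fun u => unary (I.size + 1 + u)) ++ unary (I.size + 1 + c₀.1)) := by
    intro ts b
    rw [encodePattern_ofCode]
    exact ((Emits.writeOps _).append (.flatMap .vertexOps)).append (.vertexOps _)
  have h₃ : (I.newArcs (Pattern.ofCode c₀) (target ψ k)).flatMap
        (fun a => unary a.1.1 ++ unary a.1.2 ++ binary a.2) =
      ((List.range k).flatMap fun i => hubString ψ k c₀.1 I.size (I.hub i) i) ++
        hubString ψ k c₀.1 I.size I.size k := by
    have h : ∀ i, (((List.finRange (Pattern.ofCode c₀).order).filter fun u : Fin _ =>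
          target ψ k (u : ℕ) = i).flatMap fun u =>
        [((I.newVertex (Pattern.ofCode c₀) u, I.hubVertex (Pattern.ofCode c₀) i), 0),
          ((I.hubVertex (Pattern.ofCode c₀) i, I.newVertex (Pattern.ofCode c₀) u), 0)]).flatMap
        (fun a => unary a.1.1 ++ unary a.1.2 ++ binary a.2) =
        hubString ψ k c₀.1 I.size (I.hub i) i := by
      intro i
      rw [List.flatMap_assoc, hubString, ← List.map_coe_finRange_eq_range, List.filter_map,
        List.flatMap_map]
      congr 1
      funext u
      simp [Input.newVertex, Input.hubVertex, binary]
    rw [Input.newArcs, List.flatMap_assoc]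
    simp only [h]
    rw [← hk, List.range_succ, List.flatMap_append, List.flatMap_singleton,
      I.hub_of_le (hk ▸ le_rfl)]
  have h₄ : encodeInput (I.build (Pattern.ofCode c₀) (target ψ k)) =
      encodePattern (Pattern.ofCode c₀) ++ (List.range c₀.1).flatMap
        (fun u => unary (I.size + 1 + u)) ++ unary (I.size + 1 + c₀.1) ++ binary I.budget ++
        ((I.newArcs (Pattern.ofCode c₀) (target ψ k)).flatMap
          (fun a => unary a.1.1 ++ unary a.1.2 ++ binary a.2) ++ I.arcString) := by
    have h₅ : (I.newArcs (Pattern.ofCode c₀) (target ψ k) ++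
        I.arcs.map (I.oldArc (Pattern.ofCode c₀))).flatMap
        (fun a => unary a.1.1 ++ unary a.1.2 ++ binary a.2) =
        (I.newArcs (Pattern.ofCode c₀) (target ψ k)).flatMap
          (fun a => unary a.1.1 ++ unary a.1.2 ++ binary a.2) ++ I.arcString := by
      rw [List.flatMap_append, List.flatMap_map]; rfl
    rw [← h₅, ← flatMap_finRange]
    rfl
  rw [h₄, h₃, buildOps, runOps_append, h₁, runOps_append, runOps_hubs, runOps_append]
  have h₆ : ∀ o ts, runOps (.budget :: writeOps [none]) ⟨o, ts, I.size, I.budget.bits⟩ =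
    ⟨I.budget.bits.map some ++ none :: o, ts, I.size, []⟩ := fun _ _ => rfl
  rw [h₆, h₂]
  simp [binary]

/-! ### An instance without a solution -/

/-- An instance that has no solution: two terminals, one edge in the pattern, and no arcs. -/
def noInput : Input where
  pattern := ⟨2, ⟨fun i j => i = 0 ∧ j = 1⟩⟩
  size := 2
  terminal := Function.Embedding.refl _
  budget := 0
  arcs := []
  nodup_arcs := List.nodup_nil

/-- Inputs with a pattern outside `𝓗''` must leave the language. An input without solution does so
whether or not its pattern lies in `𝓗`. -/
theorem not_yes_noInput : ¬ ∃ N, noInput.IsSolution N ∧ noInput.cost N ≤ noInput.budget := by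
  rintro ⟨N, ⟨hN, h⟩, -⟩
  have hp := h (0 : Fin 2) (1 : Fin 2) ⟨rfl, rfl⟩
  rcases Relation.ReflTransGen.cases_head hp with h | ⟨x, ⟨w, hw⟩, -⟩
  · exact absurd (congrArg Fin.val h) (by decide)
  · exact absurd (hN _ hw) List.not_mem_nil

/-- Instructions that write the instance without solution. -/
noncomputable def noOps : List Op := writeOps (encodeInput noInput) ++ [.clear]

theorem runOps_noOps (R : Regs) : (runOps noOps R).out = encodeInput noInput := by
  have : Emits R.terms R.size R.budget (writeOps (encodeInput noInput)) _ := .writeOps _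
  rw [noOps, runOps_append]
  change (runOps _ ⟨[], R.terms, R.size, R.budget⟩).out = _
  rw [this]
  simp

theorem two_le_length_noOps : 2 ≤ noOps.length := by
  simp [noOps, writeOps, encodeInput, encodePattern, unary, noInput]

/-- The order is written in unary, so any bound on the program length also bounds the new parameter.
-/
theorem le_length_buildOps (ψ : List ℕ) (k : ℕ) (c₀ : ℕ × List (ℕ × ℕ)) :
    c₀.1 ≤ (buildOps ψ k c₀).length := by
  simp [buildOps, writeOps, unary]

end DSN

/-! ### Searching for a program: semidecidability of links and computability. -/

namespace DSN

open Relation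

/-! ### Reachability -/

/-- The vertices that are reachable from `a` by at most `m` pairs of the list `E`. -/
def reachFrom (E : List (ℕ × ℕ)) (m a : ℕ) : List ℕ :=
  (fun L => L ++ (E.filter fun e => e.1 ∈ L).map Prod.snd)^[m] [a]

theorem mem_reachFrom_succ {E : List (ℕ × ℕ)} {m a b : ℕ} :
    b ∈ reachFrom E (m + 1) a ↔
      b ∈ reachFrom E m a ∨ ∃ x ∈ reachFrom E m a, (x, b) ∈ E := by
  rw [reachFrom, Function.iterate_succ_apply']
  simp only [List.mem_append, List.mem_map, List.mem_filter, decide_eq_true_eq]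
  refine or_congr Iff.rfl ⟨?_, ?_⟩
  · rintro ⟨⟨x, y⟩, ⟨h, hx⟩, rfl⟩
    exact ⟨x, hx, h⟩
  · rintro ⟨x, hx, h⟩
    exact ⟨(x, b), ⟨h, hx⟩, rfl⟩

theorem reachFrom_mono {E : List (ℕ × ℕ)} {m n a b : ℕ} (h : m ≤ n) (hb : b ∈ reachFrom E m a) :
    b ∈ reachFrom E n a := by
  induction h with
  | refl => exact hb
  | step _ ih => exact mem_reachFrom_succ.2 (.inl ih)

theorem exists_mem_reachFrom {E : List (ℕ × ℕ)} {a b : ℕ} :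
    (∃ m, b ∈ reachFrom E m a) ↔ ReflTransGen (pairRel E) a b := by
  constructor
  · rintro ⟨m, h⟩
    induction m generalizing b with
    | zero => rw [List.mem_singleton.1 h]
    | succ m ih =>
      rcases mem_reachFrom_succ.1 h with h | ⟨x, hx, h⟩
      · exact ih h
      · exact (ih hx).tail h
  · intro h
    induction h with
    | refl => exact ⟨0, List.mem_singleton_self a⟩
    | tail _ h ih =>
      obtain ⟨m, hm⟩ := ih
      exact ⟨m + 1, mem_reachFrom_succ.2 (.inr ⟨_, hm, h⟩)⟩

/-- All pairs in `E'` are connected by at most `m` pairs of `E`. -/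
def ReachAll (m : ℕ) (E E' : List (ℕ × ℕ)) : Prop := ∀ e ∈ E', e.2 ∈ reachFrom E m e.1

theorem ReachAll.mono {m n : ℕ} {E E' : List (ℕ × ℕ)} (h : ReachAll m E E') (hn : m ≤ n) :
    ReachAll n E E' := fun e he => reachFrom_mono hn (h e he)

/-- With a common step bound `m` carried by the certificate, checking reachability is primitive
recursive, and no a priori bound on path lengths is needed. -/
theorem exists_reachAll {E E' : List (ℕ × ℕ)} :
    (∃ m, ReachAll m E E') ↔ ∀ e ∈ E', ReflTransGen (pairRel E) e.1 e.2 := by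
  refine ⟨fun ⟨m, h⟩ e he => exists_mem_reachFrom.1 ⟨m, h e he⟩, fun h => ?_⟩
  induction E' with
  | nil => exact ⟨0, fun e he => absurd he List.not_mem_nil⟩
  | cons e E' ih =>
    obtain ⟨m, hm⟩ := ih fun e he => h e (List.mem_cons_of_mem _ he)
    obtain ⟨n, hn⟩ := exists_mem_reachFrom.2 (h e List.mem_cons_self)
    refine ⟨max m n, fun e' he' => ?_⟩
    rcases List.mem_cons.1 he' with rfl | he'
    · exact reachFrom_mono (le_max_right _ _) hn
    · exact hm.mono (le_max_left _ _) e' he'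

/-! ### Computability -/

section computability

open Primrec

variable {α β : Type*} [Primcodable α] [Primcodable β]

theorem primrecRel_mem [DecidableEq α] : PrimrecRel fun (a : α) (l : List α) => a ∈ l :=
  PrimrecRel.of_eq (PrimrecRel.exists_mem_list Primrec.eq).swap fun a l => by simp

theorem primrec_filter {l : α → List β} {R : β → α → Prop} [DecidableRel R] (hl : Primrec l)
    (hR : PrimrecRel R) : Primrec fun a => (l a).filter fun b => R b a :=
  hR.listFilter.comp hl .id

theorem primrec_reachFrom :
    Primrec fun x : List (ℕ × ℕ) × ℕ × ℕ => reachFrom x.1 x.2.1 x.2.2 := by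
  refine nat_iterate (fst.comp snd) (list_cons.comp (snd.comp snd) (const []))
    (h := fun (x : List (ℕ × ℕ) × ℕ × ℕ) L => L ++ (x.1.filter fun e => e.1 ∈ L).map Prod.snd) ?_
  refine list_append.comp snd (list_map ?_ (snd.comp snd).to₂)
  exact primrec_filter (R := fun e (p : (List (ℕ × ℕ) × ℕ × ℕ) × List ℕ) => e.1 ∈ p.2)
    (fst.comp fst) (primrecRel_mem.comp (fst.comp fst) (snd.comp snd))

theorem primrecRel_reachAll :
    PrimrecRel fun (m : ℕ) (x : List (ℕ × ℕ) × List (ℕ × ℕ)) => ReachAll m x.1 x.2 := by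
  have : PrimrecRel fun (e : ℕ × ℕ) (y : ℕ × List (ℕ × ℕ)) => e.2 ∈ reachFrom y.2 y.1 e.1 :=
    primrecRel_mem.comp (snd.comp fst) (primrec_reachFrom.comp ((snd.comp snd).pair
      ((fst.comp snd).pair (fst.comp fst))))
  exact this.forall_mem_list.comp (snd.comp snd) (fst.pair (fst.comp snd))

theorem primrec_matrixBits : Primrec matrixBits := by
  have hk : Primrec fun x : (ℕ × List (ℕ × ℕ)) × ℕ => x.1.1 := fst.comp fst
  exact list_map (list_range.comp (nat_mul.comp fst fst)) (PrimrecPred.decide <|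
    primrecRel_mem.comp ((nat_div.comp snd hk).pair (nat_mod.comp snd hk)) (snd.comp fst)).to₂

theorem primrec_codeEdges : Primrec codeEdges :=
  primrec_filter (R := fun (e : ℕ × ℕ) (c : ℕ × List (ℕ × ℕ)) => e.1 < c.1 ∧ e.2 < c.1) snd
    ((nat_lt.comp (fst.comp fst) (fst.comp snd)).and (nat_lt.comp (snd.comp fst) (fst.comp snd)))

theorem primrec_target : Primrec fun x : List ℕ × ℕ × ℕ => target x.1 x.2.1 x.2.2 := by
  refine nat_min.comp ?_ (fst.comp snd)
  exact (option_getD.comp (list_getElem?.comp fst (snd.comp snd)) (fst.comp snd)).of_eq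
    fun x => (List.getD_eq_getElem?_getD).symm

theorem primrec_imageEdges :
    Primrec fun x : List ℕ × ℕ × ℕ × List (ℕ × ℕ) => imageEdges x.1 x.2.1 x.2.2 := by
  have h : Primrec fun y : (List ℕ × ℕ × ℕ × List (ℕ × ℕ)) × ℕ => target y.1.1 y.1.2.1 y.2 :=
    primrec_target.comp ((fst.comp fst).pair ((fst.comp (snd.comp fst)).pair snd))
  exact list_map (primrec_codeEdges.comp (snd.comp snd)) ((h.comp (fst.pair (fst.comp snd))).pair
    (h.comp (fst.pair (snd.comp snd)))).to₂

instance : Primcodable Op :=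
  Primcodable.ofEquiv (Bool × Bool × Bool)
    ⟨Op.bits, fun b => Op.ofBits b.1 b.2.1 b.2.2, Op.ofBits_bits, by decide⟩

theorem Op.bits_injective : Function.Injective Op.bits := fun o o' h => by
  rw [← o.ofBits_bits, h, o'.ofBits_bits]

instance : Finite Op := Finite.of_injective Op.bits Op.bits_injective

theorem primrec_unary : Primrec unary := by
  refine (list_append.comp (list_map list_range (const (some true)).to₂) (const [none])).of_eq
    fun n => ?_
  simp [unary]

theorem primrec_writeOps : Primrec writeOps := list_map .id ((dom_finite Op.write).comp snd).to₂

theorem primrec_vertexOps : Primrec vertexOps :=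
  list_cons.comp (const _) (primrec_writeOps.comp (primrec_unary.comp succ))

theorem primrec_linkOps (h : Op) : Primrec (linkOps h) :=
  list_append.comp primrec_vertexOps (list_append.comp (list_append.comp
    (const ([h] ++ writeOps [none, none] ++ ([h] ++ writeOps [none]))) primrec_vertexOps)
    (const (writeOps [none])))

theorem primrec_hubOps (h : Op) :
    Primrec fun x : (List ℕ × ℕ × ℕ) × ℕ => hubOps x.1.1 x.1.2.1 x.1.2.2 h x.2 := by
  refine list_flatMap (primrec_filter
    (R := fun u (x : (List ℕ × ℕ × ℕ) × ℕ) => target x.1.1 x.1.2.1 u = x.2)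
    (list_range.comp (snd.comp (snd.comp fst))) ?_) ((primrec_linkOps h).comp snd).to₂
  have : Primrec fun y : ℕ × (List ℕ × ℕ × ℕ) × ℕ => target y.2.1.1 y.2.1.2.1 y.1 :=
    primrec_target.comp ((fst.comp (fst.comp snd)).pair
      ((fst.comp (snd.comp (fst.comp snd))).pair fst))
  exact Primrec.eq.comp this (snd.comp snd)

theorem primrec_buildOps :
    Primrec fun x : List ℕ × ℕ × ℕ × List (ℕ × ℕ) => buildOps x.1 x.2.1 x.2.2 := by
  have hc : Primrec fun x : List ℕ × ℕ × ℕ × List (ℕ × ℕ) => x.2.2.1 := fst.comp (snd.comp snd)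
  have hk : Primrec fun x : List ℕ × ℕ × ℕ × List (ℕ × ℕ) => x.2.1 := fst.comp snd
  have hx : Primrec fun x : List ℕ × ℕ × ℕ × List (ℕ × ℕ) => (x.1, x.2.1, x.2.2.1) :=
    fst.pair (hk.pair hc)
  have h₁ : Primrec fun x : List ℕ × ℕ × ℕ × List (ℕ × ℕ) =>
      writeOps (unary x.2.2.1 ++ (matrixBits x.2.2).map some ++ [none]) :=
    primrec_writeOps.comp (list_append.comp (list_append.comp (primrec_unary.comp hc)
      (list_map (primrec_matrixBits.comp (snd.comp snd)) (option_some.comp snd).to₂)) (const _))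
  have h₂ : Primrec fun x : List ℕ × ℕ × ℕ × List (ℕ × ℕ) =>
      (List.range x.2.2.1).flatMap vertexOps :=
    list_flatMap (list_range.comp hc) (primrec_vertexOps.comp snd).to₂
  have h₃ : Primrec fun x : List ℕ × ℕ × ℕ × List (ℕ × ℕ) =>
      (List.range x.2.1).flatMap fun i => .next :: hubOps x.1 x.2.1 x.2.2.1 .term i :=
    list_flatMap (list_range.comp hk) (list_cons.comp (const _)
      ((primrec_hubOps .term).comp ((hx.comp fst).pair snd))).to₂
  exact list_append.comp (list_append.comp (list_append.comp (list_append.comp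
    (list_append.comp h₁ h₂) (primrec_vertexOps.comp hc)) (const _)) h₃)
    ((primrec_hubOps .size).comp (hx.pair hk))

/-- A list of instructions as a number. The last instruction is executed first. -/
def progNat (t : List Op) : ℕ := bitsToNat (t.reverse.flatMap Op.code)

theorem primrec_progNat : Primrec progNat :=
  primrec_bitsToNat.comp (list_flatMap list_reverse ((dom_finite Op.code).comp snd).to₂)

/-- The witness `n` is a bound for a run of a program that semidecides `p`. -/
theorem exists_primrec_of_rePred {p : α → Prop} (hp : REPred p) :
    ∃ q : α → ℕ → Bool, Primrec₂ q ∧ ∀ a, p a ↔ ∃ n, q a n := by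
  obtain ⟨f, hf⟩ := Nat.Partrec.Code.exists_code.1 hp
  refine ⟨fun a n => (f.evaln n (Encodable.encode a)).isSome, option_isSome.comp
    (Nat.Partrec.Code.primrec_evaln.comp ((snd.pair (const f)).pair (Primrec.encode.comp fst))),
    fun a => ?_⟩
  have h : (∃ x, x ∈ f.eval (Encodable.encode a)) ↔ p a := by
    rw [hf]
    simp
  rw [← h]
  simp only [Nat.Partrec.Code.evaln_complete, Option.isSome_iff_exists]
  exact exists_comm

end computability

/-! ### The function that computes the program -/

/-- A candidate for a proof that a pattern can be replaced by one of a recursively enumerable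
class: codes of both patterns, a map, and bounds for two searches. -/
abbrev Certificate := (ℕ × List (ℕ × ℕ)) × (ℕ × List (ℕ × ℕ)) × List ℕ × ℕ × ℕ

/-- The certificate shows what it is supposed to show. -/
def Certificate.Valid (q : ℕ × List (ℕ × ℕ) → ℕ → Bool) (x : Certificate) : Prop :=
  q x.2.1 x.2.2.2.1 ∧
    ReachAll x.2.2.2.2 (codeEdges x.1) (imageEdges x.2.2.1 x.1.1 x.2.1) ∧
    ReachAll x.2.2.2.2 (imageEdges x.2.2.1 x.1.1 x.2.1) (codeEdges x.1)

open Primrec in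
theorem Certificate.primrecPred_valid {q : ℕ × List (ℕ × ℕ) → ℕ → Bool} (hq : Primrec₂ q) :
    PrimrecPred (Certificate.Valid q) := by
  have h₁ : Primrec fun x : Certificate => imageEdges x.2.2.1 x.1.1 x.2.1 :=
    primrec_imageEdges.comp ((fst.comp (snd.comp snd)).pair
      ((fst.comp fst).pair (fst.comp snd)))
  have h₂ : Primrec fun x : Certificate => codeEdges x.1 := primrec_codeEdges.comp fst
  have hm : Primrec fun x : Certificate => x.2.2.2.2 := snd.comp (snd.comp (snd.comp snd))
  exact (Primrec.eq.comp (hq.comp (fst.comp snd) (fst.comp (snd.comp (snd.comp snd))))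
    (const true)).and ((primrecRel_reachAll.comp hm (h₂.pair h₁)).and
    (primrecRel_reachAll.comp hm (h₁.pair h₂)))

theorem Certificate.Valid.codeLinked {q : ℕ × List (ℕ × ℕ) → ℕ → Bool} {x : Certificate}
    (h : x.Valid q) : CodeLinked x.2.2.1 x.2.1 x.1 :=
  ⟨exists_reachAll.1 ⟨_, h.2.1⟩, exists_reachAll.1 ⟨_, h.2.2⟩⟩

theorem CodeLinked.exists_valid {q : ℕ × List (ℕ × ℕ) → ℕ → Bool} {ψ : List ℕ}
    {c₀ c : ℕ × List (ℕ × ℕ)} (h : CodeLinked ψ c₀ c) (hq : ∃ n, q c₀ n) :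
    ∃ n m, Certificate.Valid q (c, c₀, ψ, n, m) := by
  obtain ⟨n, hn⟩ := hq
  obtain ⟨m₁, h₁⟩ := exists_reachAll.2 h.1
  obtain ⟨m₂, h₂⟩ := exists_reachAll.2 h.2
  exact ⟨n, max m₁ m₂, hn, h₁.mono (le_max_left _ _), h₂.mono (le_max_right _ _)⟩

/-- The program `t` transforms instances with the pattern that has the code `c` as required. -/
def Transforms (𝓗 𝓗'' : Set Pattern) (c : ℕ × List (ℕ × ℕ)) (t : List Op) : Prop :=
  Pattern.ofCode c ∉ 𝓗'' ∧ t = noOps ∨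
    Pattern.ofCode c ∈ 𝓗'' ∧ ∃ ψ c₀, Pattern.ofCode c₀ ∈ 𝓗 ∧ CodeLinked ψ c₀ c ∧
      t = buildOps ψ c.1 c₀

theorem ofCode_eq_of_matrixBits_eq {c c' : ℕ × List (ℕ × ℕ)} (h : matrixBits c = matrixBits c') :
    Pattern.ofCode c = Pattern.ofCode c' := by
  obtain ⟨k, E⟩ := c
  obtain ⟨k', E'⟩ := c'
  obtain rfl : k = k' := Nat.mul_self_inj.1 (by
    simpa only [length_matrixBits] using congrArg List.length h)
  exact matrixBits_injective h

section search

variable (q : ℕ × List (ℕ × ℕ) → ℕ → Bool) (d : ℕ × List (ℕ × ℕ) → Bool)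

open Classical in
/-- The certificate is acceptable for the adjacency matrix with the number `N`, where `d` decides
for which patterns a proof is required. -/
noncomputable def Certificate.accept (N : ℕ) (x : Certificate) : Bool :=
  decide (bitsToNat (matrixBits x.1) = N) && (!d x.1 || decide (x.Valid q))

/-- The program given by a certificate. -/
noncomputable def Certificate.ops (x : Certificate) : List Op :=
  cond (d x.1) (buildOps x.2.2.1 x.1.1 x.2.1) noOps

variable {q d}

theorem Certificate.computable_accept (hq : Primrec₂ q) (hd : Computable d) :
    Computable₂ (Certificate.accept q d) := by
  classical
  have h₁ : Primrec fun y : ℕ × Certificate => decide (bitsToNat (matrixBits y.2.1) = y.1) :=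
    PrimrecPred.decide (Primrec.eq.comp (primrec_bitsToNat.comp
      (primrec_matrixBits.comp (Primrec.fst.comp Primrec.snd))) Primrec.fst)
  have h₂ : Primrec fun x : Certificate => decide (x.Valid q) :=
    (Certificate.primrecPred_valid hq).decide
  have h₃ : Computable fun y : ℕ × Certificate => !d y.2.1 :=
    Primrec.not.to_comp.comp (hd.comp (Computable.fst.comp Computable.snd))
  have h₄ : Computable fun y : ℕ × Certificate => !d y.2.1 || decide (y.2.Valid q) :=
    Primrec.or.to_comp.comp h₃ (h₂.to_comp.comp Computable.snd)
  refine (Primrec.and.to_comp.comp h₁.to_comp h₄).of_eq fun y => ?_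
  simp only [Certificate.accept]

theorem Certificate.computable_ops (hd : Computable d) : Computable (Certificate.ops d) := by
  have h : Primrec fun x : Certificate => (x.2.2.1, x.1.1, x.2.1) :=
    (Primrec.fst.comp (Primrec.snd.comp Primrec.snd)).pair
      ((Primrec.fst.comp Primrec.fst).pair (Primrec.fst.comp Primrec.snd))
  exact Computable.cond (hd.comp .fst) (primrec_buildOps.comp h).to_comp (.const noOps)

/-- Unbounded search through the encodings of elements of `σ` halts as soon as an acceptable one
exists. -/
theorem exists_code_search {σ : Type*} [Primcodable σ] {ok : ℕ → σ → Bool} {out : σ → ℕ}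
    (hok : Computable₂ ok) (hout : Computable out) :
    ∃ f : Turing.ToPartrec.Code, ∀ N, ((∃ x, ok N x) → (f.eval [N]).Dom) ∧
      ∀ v ∈ f.eval [N], ∃ x, ok N x ∧ v = [out x] := by
  let G : ℕ → ℕ → Option ℕ := fun N n => (Encodable.decode n : Option σ).bind fun x =>
    cond (ok N x) (some (out x)) none
  have hG : Computable₂ G := Computable.option_bind (Computable.decode.comp .snd)
    (Computable.cond (hok.comp (Computable.fst.comp .fst) .snd)
      (Computable.option_some.comp (hout.comp .snd)) (.const none)).to₂
  have hG' : ∀ N n v, v ∈ G N n ↔ ∃ x : σ, Encodable.decode n = some x ∧ ok N x ∧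
      out x = v := by
    intro N n v
    simp only [G, Option.mem_def, Option.bind_eq_some_iff]
    refine exists_congr fun x => and_congr Iff.rfl ?_
    cases ok N x <;> simp
  obtain ⟨f, hf⟩ := Turing.ToPartrec.Code.exists_code
    (Nat.Partrec'.part_iff₁.2 (Partrec.rfindOpt hG))
  have hf (N : ℕ) : f.eval [N] = pure <$> Nat.rfindOpt (G N) := hf ⟨[N], rfl⟩
  refine ⟨f, fun N => ⟨fun ⟨x, hx⟩ => ?_, fun v hv => ?_⟩⟩
  · rw [hf]
    exact Nat.rfindOpt_dom.2 ⟨Encodable.encode x, out x, (hG' _ _ _).2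
      ⟨x, Encodable.encodek x, hx, rfl⟩⟩
  · rw [hf] at hv
    obtain ⟨w, hw, rfl⟩ := (Part.mem_map_iff _).1 hv
    obtain ⟨n, hn⟩ := Nat.rfindOpt_spec hw
    obtain ⟨x, -, hx, rfl⟩ := (hG' _ _ _).1 hn
    exact ⟨x, hx, rfl⟩

end search

/-- There is an algorithm that finds programs that transform instances as required, given the
adjacency matrix of the pattern. -/
theorem exists_code_of_transforms {𝓗 𝓗'' : Set Pattern} (hRE : RecursivelyEnumerable 𝓗)
    (hsub : 𝓗'' ⊆ closureClass 𝓗) (hdec : DecidableClass 𝓗'') :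
    ∃ f : Turing.ToPartrec.Code, ∀ c, (f.eval [bitsToNat (matrixBits c)]).Dom ∧
      ∀ v ∈ f.eval [bitsToNat (matrixBits c)], ∃ c' t, Pattern.ofCode c = Pattern.ofCode c' ∧
        Transforms 𝓗 𝓗'' c' t ∧ v = [progNat t] := by
  classical
  obtain ⟨q, hq, hq'⟩ := exists_primrec_of_rePred hRE
  let d : ℕ × List (ℕ × ℕ) → Bool := fun c => decide (Pattern.ofCode c ∈ 𝓗'')
  have hd : Computable d := hdec.decide
  obtain ⟨f, hf⟩ := exists_code_search (Certificate.computable_accept hq hd)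
    (primrec_progNat.to_comp.comp (Certificate.computable_ops hd))
  refine ⟨f, fun c => ⟨(hf _).1 ?_, fun v hv => ?_⟩⟩
  · by_cases hc : Pattern.ofCode c ∈ 𝓗''
    · obtain ⟨H₀, h₀, hl⟩ := exists_linked_of_mem_closureClass (hsub hc)
      obtain ⟨E, hE⟩ := exists_ofCode H₀
      obtain ⟨ψ, hψ⟩ := Linked.codeLinked (hE.symm ▸ hl)
      obtain ⟨n, m, h⟩ := hψ.exists_valid ((hq' _).1 (hE.symm ▸ h₀))
      exact ⟨(c, (H₀.order, E), ψ, n, m), by simp [Certificate.accept, h]⟩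
    -- Outside `𝓗''` no proof is required, so the remaining entries are arbitrary.
    · exact ⟨(c, c, [], 0, 0), by simp [Certificate.accept, d, hc]⟩
  · obtain ⟨x, hx, rfl⟩ := (hf _).2 v hv
    simp only [Certificate.accept, Bool.and_eq_true, decide_eq_true_eq, Bool.or_eq_true] at hx
    -- The certificate found may contain another code than `c`, but equal matrices give the same
    -- pattern.
    refine ⟨x.1, x.ops d, ofCode_eq_of_matrixBits_eq (bitsToNat_injective hx.1).symm, ?_, rfl⟩
    by_cases hc : Pattern.ofCode x.1 ∈ 𝓗''
    · have hd : d x.1 = true := decide_eq_true hc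
      have hx : x.Valid q := by simpa [hd] using hx.2
      exact .inr ⟨hc, x.2.2.1, x.2.1, (hq' _).2 ⟨_, hx.1⟩, hx.codeLinked,
        by rw [Certificate.ops, hd, cond_true]⟩
    · have hd : d x.1 = false := decide_eq_false hc
      exact .inl ⟨hc, by rw [Certificate.ops, hd, cond_false]⟩

end DSN

/-! ### Assembling the reduction. -/

namespace DSN

open Turing PartrecToTM2

theorem trList_progNat (t : List Op) :
    trList [progNat t] = (t.reverse.flatMap Op.code).map bitSymbol ++ [.bit1, .cons] := by
  simp [trList, progNat, trNat_bitsToNat]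

/-- Turns the bound on the evaluator's output into one on the number of instructions, hence on time
and on the new parameter. -/
theorem length_le_length_trList (t : List Op) : t.length ≤ (trList [progNat t]).length := by
  rw [trList_progNat]
  simp [Op.code, List.length_flatMap]
  omega

/-- The output of a suitable program is an equivalent instance. -/
theorem Transforms.exists_input {𝓗 𝓗'' : Set Pattern} {c : ℕ × List (ℕ × ℕ)} {t : List Op}
    (h : Transforms 𝓗 𝓗'' c t) (I : Input) (hI : I.pattern = Pattern.ofCode c) :
    ∃ J : Input, (runOps t ⟨I.arcString, ((List.range I.pattern.order).map I.hub).reverse, I.size,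
        I.budget.bits⟩).out = encodeInput J ∧ J.pattern.order ≤ t.length ∧
      (I.pattern ∈ 𝓗'' → J.pattern ∈ 𝓗) ∧
      (I ∈ (problem 𝓗'').language ↔ J ∈ (problem 𝓗).language) := by
  rcases h with ⟨hc, rfl⟩ | ⟨hc, ψ, c₀, h₀, hl, rfl⟩
  · rw [← hI] at hc
    exact ⟨noInput, runOps_noOps _, two_le_length_noOps, fun h => absurd h hc,
      fun h => absurd h.1 hc, fun h => absurd h.2 not_yes_noInput⟩
  · have hk : c.1 = I.pattern.order := by rw [hI]; rfl
    refine ⟨I.build (Pattern.ofCode c₀) (target ψ c.1), ?_, le_length_buildOps _ _ _,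
      fun _ => h₀, ?_⟩
    · rw [hk]
      exact runOps_buildOps I ψ c₀
    · have hc : I.pattern ∈ 𝓗'' := hI ▸ hc
      exact ⟨fun h => ⟨h₀, (hl.yes_iff hI).1 h.2⟩, fun h => ⟨hc, (hl.yes_iff hI).2 h.2⟩⟩

theorem exists_reduction {𝓗 𝓗'' : Set Pattern} (hRE : RecursivelyEnumerable 𝓗)
    (hsub : 𝓗'' ⊆ closureClass 𝓗) (hdec : DecidableClass 𝓗'') :
    ∃ (f g : ℕ → ℕ) (M : TM2ComputableAux (Option Bool) (Option Bool)),
      Computable f ∧ Computable g ∧ ∀ I : Input, ∃ J : Input,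
        Nonempty (TM2OutputsInTime M.tm ((encodeInput I).map M.inputAlphabet.symm)
          (some ((encodeInput J).map M.outputAlphabet.symm))
          (f I.pattern.order * ((encodeInput I).length + 1))) ∧
        J.pattern.order ≤ g I.pattern.order ∧ (I.pattern ∈ 𝓗'' → J.pattern ∈ 𝓗) ∧
        (I ∈ (problem 𝓗'').language ↔ J ∈ (problem 𝓗).language) := by
  obtain ⟨e, he⟩ := exists_code_of_transforms hRE hsub hdec
  obtain ⟨T, L, hT, hL, hTL⟩ := exists_computable_bounds e (by
    rintro l ⟨k, hk⟩
    obtain ⟨E, rfl⟩ := exists_matrixBits hk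
    exact (he _).1)
  -- The summands pay for the evaluation, the execution with clearing, and the parsing; the bound
  -- `L` also serves for the new parameter.
  refine ⟨fun k => T k + 7 * 2 ^ L k + 2, L, machine (evalStart e) (evalProgram e), ?_, hL,
    fun I => ?_⟩
  · have hpow : Computable₂ ((· ^ ·) : ℕ → ℕ → ℕ) :=
      (Primrec₂.unpaired'.1 Nat.Primrec.pow).to_comp
    exact Primrec.nat_add.to_comp.comp (Primrec.nat_add.to_comp.comp hT
      (Primrec.nat_mul.to_comp.comp (.const 7) (hpow.comp (.const 2) hL))) (.const 2)
  obtain ⟨E, hE⟩ := exists_ofCode I.pattern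
  set c := (I.pattern.order, E)
  obtain ⟨v, hv⟩ := Part.dom_iff_mem.1 (he c).1
  obtain ⟨c', t, hc', ht, rfl⟩ := (he c).2 v hv
  obtain ⟨hlen, s, hs, hsteps⟩ := hTL I.pattern.order _ (length_matrixBits c) _ hv
  obtain ⟨J, hJ, hJt, hJv, hJl⟩ := ht.exists_input I (hE.symm.trans hc')
  have htL : t.length ≤ L I.pattern.order := (length_le_length_trList t).trans hlen
  refine ⟨J, ?_, hJt.trans htL, hJv, hJl⟩
  have hsteps' : StepsTo (TM2.step (evalProgram e)) s
      ⟨some (evalStart e), none, K'.elim ((matrixBits c).map bitSymbol ++ [.bit1, .cons]) [] [] []⟩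
      ⟨none, none, K'.elim ((t.reverse.flatMap Op.code).map bitSymbol ++ [.bit1, .cons])
        [] [] []⟩ := by
    rw [← trList_progNat]
    exact hsteps
  obtain ⟨n, hn, h⟩ := steps_machine (evalStart e) (evalProgram e) I.arcString none (matrixBits c)
    ((List.range I.pattern.order).map I.hub) I.size I.budget.bits t.reverse s _ rfl hsteps'
  rw [← encodeInput_eq I hE.symm] at hn h
  rw [execList_reverse, hJ] at h
  refine machine_outputs _ _ (hn.trans ?_) h
  rw [List.length_reverse]
  have h₁ : 7 * 2 ^ t.length * ((encodeInput I).length + 1) ≤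
      7 * 2 ^ L I.pattern.order * ((encodeInput I).length + 1) :=
    Nat.mul_le_mul_right _ (Nat.mul_le_mul_left _ (Nat.pow_le_pow_right two_pos htL))
  have h₂ : s ≤ T I.pattern.order * ((encodeInput I).length + 1) :=
    hs.trans (Nat.le_mul_of_pos_right _ (Nat.succ_pos _))
  rw [Nat.add_mul, Nat.add_mul]
  omega

end DSN

theorem mainTheorem10 (𝓗 𝓗'' : Set DSN.Pattern)
    (hRE : DSN.RecursivelyEnumerable 𝓗)
    (hsub : 𝓗'' ⊆ DSN.closureClass 𝓗)
    (hdec : DSN.DecidableClass 𝓗'') :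
    DSN.ParamReducible (DSN.problem 𝓗'') (DSN.problem 𝓗) := by
  obtain ⟨f, g, M, hf, hg, h⟩ := DSN.exists_reduction hRE hsub hdec
  -- The map of the reduction picks, for each input, an input encoded by the output of the machine.
  choose r hM hr hv hl using h
  refine ⟨r, f, g, Polynomial.X + 1, M, hf, hg, fun I => ?_, hr, hv, hl⟩
  rw [Polynomial.eval_add, Polynomial.eval_X, Polynomial.eval_one]
  exact hM I
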